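/- Let $L,\beta,\sigma,c_1,c_2,c_3>0$ be constants with $c_1>c_0:=\left(\frac{\sigma^2(\beta+2)(2\beta+2)}{8L^2\beta}\right)^{\frac1{2\beta+2}}$, $c_3\ge c_1$ and $c_3>c_2$. For $N\ge 2$ let $n=N^2$ and let $\mathbf I=\{\frac1N,\dots,\frac{N-1}N,1\}^2$ be the $N\times N$ grid of pixels. One observes $Y(x)=f(x)+\varepsilon(x)$, $x\in\mathbf I$, where $f$ is an unknown real function and the $\varepsilon(x)$ are i.i.d. Gaussian variables with mean $0$ and standard deviation $\sigma$. Let $x_0\in\mathbf I$, and put $$h=c_1n^{-\frac1{2\beta+2}},\qquad \eta=c_2n^{-\frac1{2\beta+2}},\qquad r=c_3n^{-\frac1{2\beta+2}}.$$ For $x\in\mathbf I$ and $s>0$ let $\mathbf W_{x,s}=\{y\in\mathbf I:\|y-x\|_\infty\le s\}$. Let $\mathbf I'$ be the set of the pixels $x_0+(\frac iN,\frac jN)\in\mathbf I$ with $i+j$ even, $\mathbf I''=\mathbf I\setminus\mathbf I'$, $\mathbf U'=\mathbf W_{x_0,h}\cap\mathbf I'$ and $\mathbf V''_x=\mathbf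 W_{x,\eta}\cap\mathbf I''$. For $x\in\mathbf U'$ put $$\widehat\rho''(x)=\big(d(x)-\sqrt2\,\sigma\big)^+,\qquad d(x)=\Big(\frac1{m''}\sum_{y}\big(Y(x+y-x_0)-Y(y)\big)^2\Big)^{1/2},$$ where the sum is over the $y\in\mathbf V''_{x_0}$ with $x+y-x_0\in\mathbf V''_x$, and $m''$ is their number (away from the border of the image these are all the $y\in\mathbf V''_{x_0}$, and $m''=\mathrm{card}\,\mathbf V''_x$; if there are none, $d(x)=0$). Let $\widehat w''$ be the minimizer of $$\Big(\sum_{x\in\mathbf U'}w(x)\widehat\rho''(x)\Big)^2+\sigma^2\sum_{x\in\mathbf U'}w(x)^2$$ over all $w\ge0$ on $\mathbf U'$ with $\sum_{x\in\mathbf U'}w(x)=1$, and define the split-sample Optimal Weights Filter by $$\widehat f'_{h,\eta}(x_0)=\sum_{x\in\mathbf U'}\widehat w''(x)Y(x).$$ Suppose that $f$ satisfies the local H\"older condition $|f(x)-f(y)|\le L\|x-y\|_\infty^\beta$ for all $x,y\in\mathbf W_{x_0,r}$. (If $c_2<c_1$ one may take $c_3=c_1$, that is, $r=h$.) Then $$\mathbb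 E\big(\widehat f'_{h,\eta}(x_0)-f(x_0)\big)^2\le C\,n^{-\frac{2\beta}{2\beta+2}}\ln n,$$ the left-hand side being finite, where the constant $C$ depends only on $L,\beta,\sigma,c_1,c_2,c_3$ (not on $N$, $f$ or $x_0$). -/

import Mathlib

open MeasureTheory ProbabilityTheory

namespace OptimalWeights

noncomputable section

/-- A pixel is given by its integer indices `(i, j)`; the pixels of the `N × N` image are those
with `1 ≤ i ≤ N` and `1 ≤ j ≤ N`. -/
def grid (N : ℕ) : Finset (ℤ × ℤ) :=
  Finset.Icc 1 (N : ℤ) ×ˢ Finset.Icc 1 (N : ℤ)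

/-- The point `(i / N, j / N)` of the unit square at which the pixel `(i, j)` sits. The norm of
`ℝ × ℝ` is the supremum norm. -/
def pos (N : ℕ) (x : ℤ × ℤ) : ℝ × ℝ :=
  ((x.1 : ℝ) / N, (x.2 : ℝ) / N)

/-- The square window of the pixels of the image at sup-distance at most `r` from `x`. It is used
with `r = h` (search window) and with `r = η` (patch window). -/
def window (N : ℕ) (x : ℤ × ℤ) (r : ℝ) : Finset (ℤ × ℤ) :=
  (grid N).filter fun y => ‖pos N y - pos N x‖ ≤ r

/-- The pixels `x₀ + (i / N, j / N)` of the image for which `i + j` is even. -/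
def evenPixels (N : ℕ) (x₀ : ℤ × ℤ) : Finset (ℤ × ℤ) :=
  (grid N).filter fun x => Even ((x.1 - x₀.1) + (x.2 - x₀.2))

/-- The remaining pixels of the image. -/
def oddPixels (N : ℕ) (x₀ : ℤ × ℤ) : Finset (ℤ × ℤ) :=
  grid N \ evenPixels N x₀

/-- The even part of the search window at `x₀`. -/
def evenWindow (N : ℕ) (x₀ : ℤ × ℤ) (h : ℝ) : Finset (ℤ × ℤ) :=
  window N x₀ h ∩ evenPixels N x₀

/-- The odd part (with respect to `x₀`) of the patch window at `x`. -/
def oddPatch (N : ℕ) (x₀ : ℤ × ℤ) (η : ℝ) (x : ℤ × ℤ) : Finset (ℤ × ℤ) :=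
  window N x η ∩ oddPixels N x₀

/-- The pixels `y` of the odd patch at `x₀` whose translate `x + (y - x₀)` is a pixel of the odd
patch at `x`. If `x - x₀` is even and the two patch windows are not cut off by the border of the
image, this is the whole odd patch at `x₀`, and `y ↦ x + (y - x₀)` maps it onto the one at `x`. -/
def matchedPatch (N : ℕ) (x₀ : ℤ × ℤ) (η : ℝ) (x : ℤ × ℤ) : Finset (ℤ × ℤ) :=
  (oddPatch N x₀ η x₀).filter fun y => x + (y - x₀) ∈ oddPatch N x₀ η x

/-- The normalized distance of the odd data patches at `x` and at `x₀`, for the data `Y`. -/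
def patchDist (N : ℕ) (x₀ : ℤ × ℤ) (η : ℝ) (Y : ℤ × ℤ → ℝ) (x : ℤ × ℤ) : ℝ :=
  √((∑ y ∈ matchedPatch N x₀ η x, (Y (x + (y - x₀)) - Y y) ^ 2) / (matchedPatch N x₀ η x).card)

/-- The estimate `(d - √2 σ)⁺` of the brightness variation `|f(x) - f(x₀)|`. -/
def rhoHat (N : ℕ) (σ : ℝ) (x₀ : ℤ × ℤ) (η : ℝ) (Y : ℤ × ℤ → ℝ) (x : ℤ × ℤ) : ℝ :=
  max (patchDist N x₀ η Y x - √2 * σ) 0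

/-- The objective function that the weights `w` on `U` have to minimize. -/
def objective (U : Finset (ℤ × ℤ)) (σ : ℝ) (ρ w : ℤ × ℤ → ℝ) : ℝ :=
  (∑ x ∈ U, w x * ρ x) ^ 2 + σ ^ 2 * ∑ x ∈ U, w x ^ 2

/-- Nonnegative weights on `U` with total mass one. -/
def IsWeight (U : Finset (ℤ × ℤ)) (w : ℤ × ℤ → ℝ) : Prop :=
  (∀ x ∈ U, 0 ≤ w x) ∧ ∑ x ∈ U, w x = 1

/-- `w` minimizes the objective function among all weights on `U`. -/
def IsOptimalWeight (U : Finset (ℤ × ℤ)) (σ : ℝ) (ρ w : ℤ × ℤ → ℝ) : Prop :=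
  IsWeight U w ∧ ∀ v, IsWeight U v → objective U σ ρ w ≤ objective U σ ρ v

/-- The minimizing weights on `U`. Only their values on `U` matter. -/
def optimalWeight (U : Finset (ℤ × ℤ)) (σ : ℝ) (ρ : ℤ × ℤ → ℝ) : ℤ × ℤ → ℝ :=
  Classical.epsilon fun w => IsOptimalWeight U σ ρ w

/-- Minimizing weights exist, so that `optimalWeight` is one of them. -/
theorem isOptimalWeight_optimalWeight (U : Finset (ℤ × ℤ)) (hU : U.Nonempty) (σ : ℝ)
    (ρ : ℤ × ℤ → ℝ) : IsOptimalWeight U σ ρ (optimalWeight U σ ρ) := by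
  classical
  refine Classical.epsilon_spec (p := fun w => IsOptimalWeight U σ ρ w) ?_
  obtain ⟨x₁, hx₁⟩ := hU
  let K : Set (ℤ × ℤ → ℝ) :=
    Set.pi Set.univ (fun _ => Set.Icc (0 : ℝ) 1) ∩ {w | ∑ x ∈ U, w x = 1}
  have hK : IsCompact K := by
    refine (isCompact_univ_pi fun _ => isCompact_Icc).inter_right ?_
    exact isClosed_eq (by fun_prop) continuous_const
  have hcont : Continuous (objective U σ ρ) := by
    unfold objective
    fun_prop
  have hne : K.Nonempty := by
    refine ⟨fun x => if x = x₁ then 1 else 0, ?_, ?_⟩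
    · intro x _
      by_cases h : x = x₁ <;> simp [h]
    · simp [hx₁]
  obtain ⟨w, ⟨hw1, hw2⟩, hmin⟩ := hK.exists_isMinOn hne hcont.continuousOn
  refine ⟨w, ⟨fun x _ => (hw1 x trivial).1, hw2⟩, fun v hv => ?_⟩
  let v' : ℤ × ℤ → ℝ := fun x => if x ∈ U then v x else 0
  have hv' : ∀ x ∈ U, v' x = v x := fun x hx => if_pos hx
  have hobj : objective U σ ρ v' = objective U σ ρ v := by
    have e1 : ∑ x ∈ U, v' x * ρ x = ∑ x ∈ U, v x * ρ x :=
      Finset.sum_congr rfl fun x hx => by rw [hv' x hx]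
    have e2 : ∑ x ∈ U, v' x ^ 2 = ∑ x ∈ U, v x ^ 2 :=
      Finset.sum_congr rfl fun x hx => by rw [hv' x hx]
    unfold objective
    rw [e1, e2]
  rw [← hobj]
  refine hmin ⟨fun x _ => ?_, ?_⟩
  · by_cases hx : x ∈ U
    · rw [hv' x hx]
      exact ⟨hv.1 x hx, hv.2 ▸ Finset.single_le_sum (f := v) hv.1 hx⟩
    · simp [v', hx]
  · change ∑ x ∈ U, v' x = 1
    rw [Finset.sum_congr rfl hv', hv.2]

/-- The minimizing weights are unique on `U`. -/
theorem IsOptimalWeight.eq_on {U : Finset (ℤ × ℤ)} {σ : ℝ} (hσ : 0 < σ) {ρ w v : ℤ × ℤ → ℝ}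
    (hw : IsOptimalWeight U σ ρ w) (hv : IsOptimalWeight U σ ρ v) : ∀ x ∈ U, w x = v x := by
  let u : ℤ × ℤ → ℝ := fun x => (w x + v x) / 2
  have hu : IsWeight U u := by
    refine ⟨fun x hx => ?_, ?_⟩
    · have h1 := hw.1.1 x hx
      have h2 := hv.1.1 x hx
      change 0 ≤ (w x + v x) / 2
      linarith
    · change ∑ x ∈ U, (w x + v x) / 2 = 1
      rw [← Finset.sum_div, Finset.sum_add_distrib, hw.1.2, hv.1.2]
      norm_num
  have e1 : ∑ x ∈ U, u x * ρ x = (∑ x ∈ U, w x * ρ x + ∑ x ∈ U, v x * ρ x) / 2 := by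
    rw [← Finset.sum_add_distrib, Finset.sum_div]
    exact Finset.sum_congr rfl fun x _ => by simp only [u]; ring
  have e2 : ∑ x ∈ U, u x ^ 2 =
      (∑ x ∈ U, w x ^ 2 + ∑ x ∈ U, v x ^ 2) / 2 - (∑ x ∈ U, (w x - v x) ^ 2) / 4 := by
    rw [← Finset.sum_add_distrib, Finset.sum_div, Finset.sum_div, ← Finset.sum_sub_distrib]
    exact Finset.sum_congr rfl fun x _ => by simp only [u]; ring
  have h1 := hw.2 u hu
  have h2 := hv.2 u hu
  have h3 : objective U σ ρ u ≤ (objective U σ ρ w + objective U σ ρ v) / 2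
      - σ ^ 2 * (∑ x ∈ U, (w x - v x) ^ 2) / 4 := by
    unfold objective
    rw [e1, e2]
    nlinarith [sq_nonneg (∑ x ∈ U, w x * ρ x - ∑ x ∈ U, v x * ρ x)]
  have h4 : ∑ x ∈ U, (w x - v x) ^ 2 = 0 := by
    refine le_antisymm ?_ (Finset.sum_nonneg fun x _ => sq_nonneg _)
    have : 0 < σ ^ 2 := by positivity
    by_contra! hlt
    nlinarith [mul_pos this hlt]
  intro x hx
  have h5 := (Finset.sum_eq_zero_iff_of_nonneg fun x _ => sq_nonneg (w x - v x)).1 h4 x hx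
  exact sub_eq_zero.1 (pow_eq_zero_iff two_ne_zero |>.1 h5)

/-- The split-sample Optimal Weights Filter at `x₀`, for the data `Y`: the weights are computed
from the odd pixels, and the average is taken over the even pixels of the search window. -/
def filterEstimate (N : ℕ) (σ h η : ℝ) (x₀ : ℤ × ℤ) (Y : ℤ × ℤ → ℝ) : ℝ :=
  ∑ x ∈ evenWindow N x₀ h,
    optimalWeight (evenWindow N x₀ h) σ (rhoHat N σ x₀ η Y) x * Y x

/-- The noise at the pixels of the image is i.i.d. centred Gaussian with standard deviation `σ`. -/
structure IsGaussianNoise {Ω : Type*} [MeasurableSpace Ω] (P : Measure Ω) (N : ℕ) (σ : ℝ)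
    (ε : ℤ × ℤ → Ω → ℝ) : Prop where
  law : ∀ x ∈ grid N, HasLaw (ε x) (gaussianReal 0 (σ ^ 2).toNNReal) P
  indep : iIndepFun (fun x : {x : ℤ × ℤ // x ∈ grid N} => ε x) P

/-- The observed image `Y(x) = f(x) + ε(x)`. -/
def observation {Ω : Type*} (N : ℕ) (f : ℝ × ℝ → ℝ) (ε : ℤ × ℤ → Ω → ℝ) (ω : Ω)
    (x : ℤ × ℤ) : ℝ :=
  f (pos N x) + ε x ω

/-- The local Hölder condition for `f` at the pixels of the window of radius `r` at `x₀`. -/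
def LocalHolder (N : ℕ) (f : ℝ × ℝ → ℝ) (L β : ℝ) (x₀ : ℤ × ℤ) (r : ℝ) : Prop :=
  ∀ x ∈ window N x₀ r, ∀ y ∈ window N x₀ r,
    |f (pos N x) - f (pos N y)| ≤ L * ‖pos N x - pos N y‖ ^ β

/-- The constant `c₀ = (σ² (β + 2) (2 β + 2) / (8 L² β)) ^ (1 / (2 β + 2))`. -/
def cZero (L β σ : ℝ) : ℝ :=
  (σ ^ 2 * (β + 2) * (2 * β + 2) / (8 * L ^ 2 * β)) ^ (1 / (2 * β + 2))

end

end OptimalWeights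

namespace OptimalWeights

noncomputable section

/-! ### Optimal weights -/

/-! Put `A = L * h ^ β`. The weights are nonnegative, sum to one and live on the search window, so
the bias is at most `A` whatever the data. The weights depend on the odd data only, while the
averaged noise sits on even pixels; by independence the noise contributes exactly `σ²` times the
expected sum of squared weights (`integral_sq_sum_weights`). Minimality controls this sum: `σ² ∑ w²`
is at most the minimal objective, hence at most the objective at the uniform weights on a smaller
even window of radius `s`, which is at most the mean of `rhoHat ^ 2` there plus `σ²` over its
cardinality (`IsOptimalWeight.sum_sq_le`). Taking `s + η ≤ r` keeps the compared patches inside the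
Hölder window.

For the second moment of `rhoHat`, Minkowski's inequality separates the brightness differences, at
most `A`, from the noise distance (`rhoHat_sq_le`). The square of the latter has mean `2 σ²` and
averages terms each correlated with at most three, itself included, so its variance is of order one
over the patch size (`integral_sq_noiseDistSq_sub_le`). Second moments, averaged over the small
window, suffice; no uniform deviation bound is needed, and no logarithm arises.

All radii are of order `n ^ (-1/(2β+2))`, and even at the border a fixed proportion of a small
window lies in the image, so every term has order `n ^ (-2β/(2β+2))`. -/

theorem IsWeight.le_one {U : Finset (ℤ × ℤ)} {w : ℤ × ℤ → ℝ} (hw : IsWeight U w) {x : ℤ × ℤ}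
    (hx : x ∈ U) : w x ≤ 1 :=
  hw.2 ▸ Finset.single_le_sum (f := w) hw.1 hx

/-- The objective grows at least quadratically away from its minimizer. -/
theorem IsOptimalWeight.sq_dist_le {U : Finset (ℤ × ℤ)} {σ : ℝ} {ρ w v : ℤ × ℤ → ℝ}
    (hw : IsOptimalWeight U σ ρ w) (hv : IsWeight U v) :
    σ ^ 2 * (∑ x ∈ U, (w x - v x) ^ 2) ≤ 2 * (objective U σ ρ v - objective U σ ρ w) := by
  let u : ℤ × ℤ → ℝ := fun x => (w x + v x) / 2
  have hu : IsWeight U u := by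
    refine ⟨fun x hx => ?_, ?_⟩
    · have h1 := hw.1.1 x hx
      have h2 := hv.1 x hx
      change 0 ≤ (w x + v x) / 2
      linarith
    · change ∑ x ∈ U, (w x + v x) / 2 = 1
      rw [← Finset.sum_div, Finset.sum_add_distrib, hw.1.2, hv.2]
      norm_num
  have e1 : ∑ x ∈ U, u x * ρ x = (∑ x ∈ U, w x * ρ x + ∑ x ∈ U, v x * ρ x) / 2 := by
    rw [← Finset.sum_add_distrib, Finset.sum_div]
    exact Finset.sum_congr rfl fun x _ => by simp only [u]; ring
  have e2 : ∑ x ∈ U, u x ^ 2 =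
      (∑ x ∈ U, w x ^ 2 + ∑ x ∈ U, v x ^ 2) / 2 - (∑ x ∈ U, (w x - v x) ^ 2) / 4 := by
    rw [← Finset.sum_add_distrib, Finset.sum_div, Finset.sum_div, ← Finset.sum_sub_distrib]
    exact Finset.sum_congr rfl fun x _ => by simp only [u]; ring
  have h1 := hw.2 u hu
  have h3 : objective U σ ρ u ≤ (objective U σ ρ w + objective U σ ρ v) / 2
      - σ ^ 2 * (∑ x ∈ U, (w x - v x) ^ 2) / 4 := by
    unfold objective
    rw [e1, e2]
    nlinarith [sq_nonneg (∑ x ∈ U, w x * ρ x - ∑ x ∈ U, v x * ρ x)]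
  linarith

/-- The `σ` terms cancel and the difference of two squares factors; each weight is at most one. -/
theorem IsWeight.abs_objective_sub_le {U : Finset (ℤ × ℤ)} {w : ℤ × ℤ → ℝ} (hw : IsWeight U w)
    (σ : ℝ) (ρ ρ' : ℤ × ℤ → ℝ) :
    |objective U σ ρ w - objective U σ ρ' w| ≤
      (∑ x ∈ U, |ρ x - ρ' x|) * ∑ x ∈ U, |ρ x + ρ' x| := by
  have key : ∀ g : ℤ × ℤ → ℝ, |∑ x ∈ U, w x * g x| ≤ ∑ x ∈ U, |g x| := fun g =>
    (Finset.abs_sum_le_sum_abs _ _).trans <| Finset.sum_le_sum fun x hx => by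
      rw [abs_mul, abs_of_nonneg (hw.1 x hx)]
      exact mul_le_of_le_one_left (abs_nonneg _) (hw.le_one hx)
  have e : objective U σ ρ w - objective U σ ρ' w =
      (∑ x ∈ U, w x * (ρ x - ρ' x)) * ∑ x ∈ U, w x * (ρ x + ρ' x) := by
    simp only [objective, mul_sub, mul_add, Finset.sum_sub_distrib, Finset.sum_add_distrib]
    ring
  rw [e, abs_mul]
  exact mul_le_mul (key _) (key _) (abs_nonneg _) (Finset.sum_nonneg fun _ _ => abs_nonneg _)

/-- Adding the quadratic growth inequalities at the two minimizers leaves only changes of the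
objective at fixed weights. The resulting continuity in `ρ` makes the data-driven weights
measurable. -/
theorem sq_optimalWeight_sub_le {U : Finset (ℤ × ℤ)} {σ : ℝ} (hσ : 0 < σ)
    (ρ ρ' : ℤ × ℤ → ℝ) {x : ℤ × ℤ} (hx : x ∈ U) :
    (optimalWeight U σ ρ' x - optimalWeight U σ ρ x) ^ 2 ≤
      2 / σ ^ 2 * ((∑ x ∈ U, |ρ' x - ρ x|) * ∑ x ∈ U, |ρ' x + ρ x|) := by
  have h := isOptimalWeight_optimalWeight U ⟨x, hx⟩ σ ρ
  have h' := isOptimalWeight_optimalWeight U ⟨x, hx⟩ σ ρ'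
  set w := optimalWeight U σ ρ
  set w' := optimalWeight U σ ρ'
  have h1 := h.sq_dist_le h'.1
  have h2 := h'.sq_dist_le h.1
  have h3 := (abs_le.1 (h.1.abs_objective_sub_le σ ρ' ρ)).2
  have h4 := (abs_le.1 (h'.1.abs_objective_sub_le σ ρ' ρ)).1
  have h5 : (w' x - w x) ^ 2 ≤ ∑ x ∈ U, (w' x - w x) ^ 2 :=
    Finset.single_le_sum (f := fun x => (w' x - w x) ^ 2) (fun _ _ => sq_nonneg _) hx
  have h6 : ∑ x ∈ U, (w x - w' x) ^ 2 = ∑ x ∈ U, (w' x - w x) ^ 2 :=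
    Finset.sum_congr rfl fun _ _ => by ring
  rw [h6] at h1
  have hs : 0 < σ ^ 2 := by positivity
  rw [div_mul_eq_mul_div, le_div_iff₀ hs]
  have h7 := mul_le_mul_of_nonneg_left h5 hs.le
  linarith

/-- On the search window, the minimizing weights depend continuously on the similarity. -/
theorem continuous_optimalWeight {U : Finset (ℤ × ℤ)} {σ : ℝ} (hσ : 0 < σ) {x : ℤ × ℤ}
    (hx : x ∈ U) : Continuous fun ρ => optimalWeight U σ ρ x := by
  rw [continuous_iff_continuousAt]
  intro ρ
  have hc : Continuous fun ρ' : ℤ × ℤ → ℝ =>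
      √(2 / σ ^ 2 * ((∑ x ∈ U, |ρ' x - ρ x|) * ∑ x ∈ U, |ρ' x + ρ x|)) := by fun_prop
  have h0 := hc.tendsto ρ
  simp only [sub_self, abs_zero, Finset.sum_const_zero, zero_mul, mul_zero, Real.sqrt_zero] at h0
  rw [ContinuousAt, tendsto_iff_dist_tendsto_zero]
  refine squeeze_zero (fun _ => dist_nonneg) (fun ρ' => ?_) h0
  rw [Real.dist_eq]
  exact Real.abs_le_sqrt (sq_optimalWeight_sub_le hσ ρ ρ' hx)

/-- The spread of the minimizing weights is bounded through the uniform weights on a subset. -/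
theorem IsOptimalWeight.sum_sq_le {U S : Finset (ℤ × ℤ)} {σ : ℝ} {ρ w : ℤ × ℤ → ℝ}
    (hw : IsOptimalWeight U σ ρ w) (hSU : S ⊆ U) (hS : S.Nonempty) :
    σ ^ 2 * ∑ x ∈ U, w x ^ 2 ≤ (∑ x ∈ S, ρ x ^ 2) / S.card + σ ^ 2 / S.card := by
  have hc : (0 : ℝ) < S.card := by exact_mod_cast hS.card_pos
  let v : ℤ × ℤ → ℝ := fun x => if x ∈ S then (S.card : ℝ)⁻¹ else 0
  -- Any sum over `U` whose terms vanish at weight zero reduces to `S`; used for the mass and for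
  -- both parts of the objective.
  have hsum : ∀ g : ℤ × ℤ → ℝ → ℝ, (∀ x, g x 0 = 0) →
      ∑ x ∈ U, g x (v x) = ∑ x ∈ S, g x (S.card : ℝ)⁻¹ := fun g hg => by
    rw [← Finset.sum_subset hSU fun x _ hx => by simp [v, hx, hg]]
    exact Finset.sum_congr rfl fun x hx => by simp [v, hx]
  have hv : IsWeight U v := by
    refine ⟨fun x _ => ?_, ?_⟩
    · simp only [v]
      split_ifs <;> positivity
    · rw [hsum (fun _ t => t) fun _ => rfl]
      simp [hc.ne']
  have h1 := hw.2 v hv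
  have h2 : objective U σ ρ v = ((∑ x ∈ S, ρ x) / S.card) ^ 2 + σ ^ 2 / S.card := by
    unfold objective
    rw [hsum (fun x t => t * ρ x) fun _ => by simp, hsum (fun _ t => t ^ 2) fun _ => by simp,
      ← Finset.mul_sum]
    simp only [Finset.sum_const, nsmul_eq_mul]
    field_simp
  have h3 : ((∑ x ∈ S, ρ x) / S.card) ^ 2 ≤ (∑ x ∈ S, ρ x ^ 2) / S.card := by
    rw [div_pow, div_le_div_iff₀ (by positivity) hc]
    have := mul_le_mul_of_nonneg_right (sq_sum_le_card_mul_sum_sq (s := S) (f := ρ)) hc.le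
    calc _ ≤ _ := this
      _ = _ := by ring
  have h4 : σ ^ 2 * ∑ x ∈ U, w x ^ 2 ≤ objective U σ ρ w := by
    unfold objective
    nlinarith [sq_nonneg (∑ x ∈ U, w x * ρ x)]
  linarith

theorem IsWeight.abs_sum_mul_le {U : Finset (ℤ × ℤ)} {w g : ℤ × ℤ → ℝ} {A : ℝ}
    (hw : IsWeight U w) (hg : ∀ x ∈ U, |g x| ≤ A) : |∑ x ∈ U, w x * g x| ≤ A := by
  calc |∑ x ∈ U, w x * g x| ≤ ∑ x ∈ U, |w x * g x| := Finset.abs_sum_le_sum_abs _ _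
    _ ≤ ∑ x ∈ U, w x * A := Finset.sum_le_sum fun x hx => by
        rw [abs_mul, abs_of_nonneg (hw.1 x hx)]
        exact mul_le_mul_of_nonneg_left (hg x hx) (hw.1 x hx)
    _ = A := by rw [← Finset.sum_mul, hw.2, one_mul]

/-! ### The estimate of the brightness variation -/

/-- Minkowski's inequality for a normalized `ℓ²` norm, with a bounded perturbation. -/
theorem sqrt_mean_sq_add_le {ι : Type*} {M : Finset ι} {a b : ι → ℝ} {A : ℝ}
    (hA : 0 ≤ A) (ha : ∀ y ∈ M, |a y| ≤ A) :
    √((∑ y ∈ M, (a y + b y) ^ 2) / M.card) ≤ A + √((∑ y ∈ M, b y ^ 2) / M.card) := by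
  rcases M.eq_empty_or_nonempty with rfl | hM
  · simpa using hA
  have hc : (0 : ℝ) < M.card := by exact_mod_cast hM.card_pos
  set T := (∑ y ∈ M, b y ^ 2) / M.card with hT
  have hT0 : 0 ≤ T := div_nonneg (Finset.sum_nonneg fun _ _ => sq_nonneg _) hc.le
  -- Cauchy–Schwarz, for the cross term of the expanded square.
  have h1 : (∑ y ∈ M, |b y|) / M.card ≤ √T := by
    refine Real.le_sqrt_of_sq_le ?_
    rw [hT, div_pow, div_le_div_iff₀ (by positivity) hc]
    have := mul_le_mul_of_nonneg_right
      (sq_sum_le_card_mul_sum_sq (s := M) (f := fun y => |b y|)) hc.le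
    simp only [sq_abs] at this
    calc _ ≤ _ := this
      _ = _ := by ring
  refine Real.sqrt_le_iff.2 ⟨by positivity, ?_⟩
  have h2 : ∑ y ∈ M, (a y + b y) ^ 2 ≤
      M.card * A ^ 2 + 2 * A * (∑ y ∈ M, |b y|) + ∑ y ∈ M, b y ^ 2 := by
    rw [Finset.mul_sum, ← nsmul_eq_mul, ← Finset.sum_const, ← Finset.sum_add_distrib,
      ← Finset.sum_add_distrib]
    refine Finset.sum_le_sum fun y hy => ?_
    have h3 : a y ^ 2 ≤ A ^ 2 := sq_le_sq' (abs_le.1 (ha y hy)).1 (abs_le.1 (ha y hy)).2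
    have h4 : a y * b y ≤ A * |b y| :=
      (le_abs_self _).trans <| by
        rw [abs_mul]
        exact mul_le_mul_of_nonneg_right (ha y hy) (abs_nonneg _)
    nlinarith
  calc (∑ y ∈ M, (a y + b y) ^ 2) / M.card
      ≤ (M.card * A ^ 2 + 2 * A * (∑ y ∈ M, |b y|) + ∑ y ∈ M, b y ^ 2) / M.card :=
        div_le_div_of_nonneg_right h2 hc.le
    _ = A ^ 2 + 2 * A * ((∑ y ∈ M, |b y|) / M.card) + T := by
        rw [hT]
        field_simp
    _ ≤ A ^ 2 + 2 * A * √T + T := by gcongr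
    _ = (A + √T) ^ 2 := by
        have := Real.sq_sqrt hT0
        ring_nf
        rw [this]

/-- Since `T - 2σ² = (√T - √2 σ)(√T + √2 σ)` and the last factor is at least `√2 σ`, closeness of
`T` to `2σ²` passes to the square roots. -/
theorem sq_max_le {σ A T d : ℝ} (hσ : 0 < σ) (hT : 0 ≤ T) (hA : 0 ≤ A) (hd : d ≤ A + √T) :
    (max (d - √2 * σ) 0) ^ 2 ≤ 2 * A ^ 2 + (T - 2 * σ ^ 2) ^ 2 / σ ^ 2 := by
  have hs2 : (√2) ^ 2 = 2 := Real.sq_sqrt (by norm_num)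
  have hst : √T ^ 2 = T := Real.sq_sqrt hT
  have h0 : 0 ≤ √T := Real.sqrt_nonneg T
  have hs0 : 0 ≤ √2 := Real.sqrt_nonneg 2
  have h1 : max (d - √2 * σ) 0 ≤ A + |√T - √2 * σ| := by
    refine max_le ?_ (by positivity)
    linarith [le_abs_self (√T - √2 * σ)]
  have h2 : 2 * (√T - √2 * σ) ^ 2 ≤ (T - 2 * σ ^ 2) ^ 2 / σ ^ 2 := by
    rw [le_div_iff₀ (by positivity)]
    have e : T - 2 * σ ^ 2 = (√T - √2 * σ) * (√T + √2 * σ) := by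
      linear_combination σ ^ 2 * hs2 - hst
    rw [e, mul_pow]
    have h3 : 2 * σ ^ 2 ≤ (√T + √2 * σ) ^ 2 := by
      have : 0 ≤ √T * (√2 * σ) := by positivity
      nlinarith
    nlinarith [mul_le_mul_of_nonneg_left h3 (sq_nonneg (√T - √2 * σ))]
  calc (max (d - √2 * σ) 0) ^ 2 ≤ (A + |√T - √2 * σ|) ^ 2 := by
        gcongr
    _ ≤ 2 * A ^ 2 + 2 * (√T - √2 * σ) ^ 2 := by
        nlinarith [sq_nonneg (A - |√T - √2 * σ|), sq_abs (√T - √2 * σ)]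
    _ ≤ _ := by linarith

/-- The normalized squared distance of the noise patches at `x` and `x₀`. -/
def noiseDistSq (N : ℕ) (x₀ : ℤ × ℤ) (η : ℝ) (e : ℤ × ℤ → ℝ) (x : ℤ × ℤ) : ℝ :=
  (∑ y ∈ matchedPatch N x₀ η x, (e (x + (y - x₀)) - e y) ^ 2) / (matchedPatch N x₀ η x).card

theorem noiseDistSq_nonneg (N : ℕ) (x₀ : ℤ × ℤ) (η : ℝ) (e : ℤ × ℤ → ℝ) (x : ℤ × ℤ) :
    0 ≤ noiseDistSq N x₀ η e x :=
  div_nonneg (Finset.sum_nonneg fun _ _ => sq_nonneg _) (Nat.cast_nonneg _)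

theorem rhoHat_sq_le {N : ℕ} {σ : ℝ} (hσ : 0 < σ) {x₀ x : ℤ × ℤ} {η A : ℝ} (hA : 0 ≤ A)
    {g e : ℤ × ℤ → ℝ} (hg : ∀ y ∈ matchedPatch N x₀ η x, |g (x + (y - x₀)) - g y| ≤ A) :
    rhoHat N σ x₀ η (fun y => g y + e y) x ^ 2 ≤
      2 * A ^ 2 + (noiseDistSq N x₀ η e x - 2 * σ ^ 2) ^ 2 / σ ^ 2 := by
  refine sq_max_le hσ (noiseDistSq_nonneg ..) hA ?_
  have h := sqrt_mean_sq_add_le (b := fun y => e (x + (y - x₀)) - e y) hA hg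
  refine le_of_eq_of_le ?_ h
  simp only [patchDist, add_sub_add_comm]

/-- Division by zero gives distance `0`, and the positive part of `-√2 σ` vanishes. -/
theorem rhoHat_eq_zero_of_card {N : ℕ} {σ : ℝ} (hσ : 0 < σ) {x₀ x : ℤ × ℤ} {η : ℝ}
    (h : (matchedPatch N x₀ η x).card = 0) (Y : ℤ × ℤ → ℝ) : rhoHat N σ x₀ η Y x = 0 := by
  have : 0 ≤ √2 * σ := by positivity
  simpa [rhoHat, patchDist, h] using this

theorem rhoHat_self {N : ℕ} {σ : ℝ} (hσ : 0 < σ) {x₀ : ℤ × ℤ} {η : ℝ}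
    (Y : ℤ × ℤ → ℝ) : rhoHat N σ x₀ η Y x₀ = 0 := by
  have : 0 ≤ √2 * σ := by positivity
  simpa [rhoHat, patchDist] using this

theorem continuous_rhoHat (N : ℕ) (σ : ℝ) (x₀ : ℤ × ℤ) (η : ℝ) (x : ℤ × ℤ) :
    Continuous fun Y => rhoHat N σ x₀ η Y x := by
  unfold rhoHat patchDist
  fun_prop

/-- Matched pixels and their translates are all odd; this is the source of independence from the
even noise. -/
theorem rhoHat_congr {N : ℕ} {σ : ℝ} {x₀ : ℤ × ℤ} {η : ℝ} {Y Y' : ℤ × ℤ → ℝ}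
    (h : ∀ y ∈ oddPixels N x₀, Y y = Y' y) : rhoHat N σ x₀ η Y = rhoHat N σ x₀ η Y' := by
  funext x
  have : ∑ y ∈ matchedPatch N x₀ η x, (Y (x + (y - x₀)) - Y y) ^ 2 =
      ∑ y ∈ matchedPatch N x₀ η x, (Y' (x + (y - x₀)) - Y' y) ^ 2 := by
    refine Finset.sum_congr rfl fun y hy => ?_
    simp only [matchedPatch, oddPatch, Finset.mem_filter, Finset.mem_inter] at hy
    rw [h _ hy.1.2, h _ hy.2.2]
  simp only [rhoHat, patchDist, this]

/-! ### Windows and patches -/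

theorem norm_pos_sub_le_iff {N : ℕ} (hN : 0 < N) (x y : ℤ × ℤ) (r : ℝ) :
    ‖pos N y - pos N x‖ ≤ r ↔
      |((y.1 - x.1 : ℤ) : ℝ)| ≤ r * N ∧ |((y.2 - x.2 : ℤ) : ℝ)| ≤ r * N := by
  have hN' : (0 : ℝ) < N := by exact_mod_cast hN
  simp only [norm_prod_le_iff, pos, Prod.fst_sub, Prod.snd_sub, ← sub_div, Real.norm_eq_abs,
    abs_div, abs_of_pos hN', div_le_iff₀ hN', Int.cast_sub]

theorem mem_window_iff {N : ℕ} {x y : ℤ × ℤ} {r : ℝ} :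
    y ∈ window N x r ↔ y ∈ grid N ∧ ‖pos N y - pos N x‖ ≤ r := by
  simp [window]

theorem mem_grid_iff {N : ℕ} {x : ℤ × ℤ} :
    x ∈ grid N ↔ (1 ≤ x.1 ∧ x.1 ≤ N) ∧ 1 ≤ x.2 ∧ x.2 ≤ N := by
  simp [grid]

theorem pos_translate_sub (N : ℕ) (x x₀ y : ℤ × ℤ) :
    pos N (x + (y - x₀)) - pos N y = pos N x - pos N x₀ := by
  ext <;> simp [pos] <;> ring

theorem evenWindow_subset {N : ℕ} {x₀ : ℤ × ℤ} {s h : ℝ} (hsh : s ≤ h) :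
    evenWindow N x₀ s ⊆ evenWindow N x₀ h := fun x hx => by
  simp only [evenWindow, Finset.mem_inter, mem_window_iff] at hx ⊢
  exact ⟨⟨hx.1.1, hx.1.2.trans hsh⟩, hx.2⟩

/-- Translation by the even vector `x - x₀` preserves parity and carries the window at `x₀` to that
at `x`, so the translate only has to stay in the image. -/
theorem mem_matchedPatch_iff {N : ℕ} {x₀ x y : ℤ × ℤ} {η : ℝ}
    (hx : Even ((x.1 - x₀.1) + (x.2 - x₀.2))) :
    y ∈ matchedPatch N x₀ η x ↔ y ∈ grid N ∧ x + (y - x₀) ∈ grid N ∧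
      ‖pos N y - pos N x₀‖ ≤ η ∧ ¬ Even ((y.1 - x₀.1) + (y.2 - x₀.2)) := by
  have e : pos N (x + (y - x₀)) - pos N x = pos N y - pos N x₀ := by
    ext <;> simp [pos] <;> ring
  have p : Even ((x + (y - x₀)).1 - x₀.1 + ((x + (y - x₀)).2 - x₀.2)) ↔
      Even ((y.1 - x₀.1) + (y.2 - x₀.2)) := by
    have : (x + (y - x₀)).1 - x₀.1 + ((x + (y - x₀)).2 - x₀.2) =
        ((x.1 - x₀.1) + (x.2 - x₀.2)) + ((y.1 - x₀.1) + (y.2 - x₀.2)) := by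
      simp
      ring
    rw [this, Int.even_add]
    simp [hx]
  simp only [matchedPatch, oddPatch, oddPixels, evenPixels, Finset.mem_filter, Finset.mem_inter,
    Finset.mem_sdiff, mem_window_iff, e, p]
  tauto

/-- The Hölder condition bounds the brightness variation over the search window. -/
theorem LocalHolder.abs_sub_le {N : ℕ} {f : ℝ × ℝ → ℝ} {L β r : ℝ} {x₀ : ℤ × ℤ} (hL : 0 ≤ L)
    (hβ : 0 ≤ β) (hf : LocalHolder N f L β x₀ r) {x y : ℤ × ℤ} {h : ℝ} (hx : x ∈ window N x₀ r)
    (hy : y ∈ window N x₀ r) (hxy : ‖pos N x - pos N y‖ ≤ h) :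
    |f (pos N x) - f (pos N y)| ≤ L * h ^ β :=
  (hf x hx y hy).trans <|
    mul_le_mul_of_nonneg_left (Real.rpow_le_rpow (norm_nonneg _) hxy hβ) hL

/-- The brightness variation between matched patches. -/
theorem LocalHolder.abs_translate_sub_le {N : ℕ} {f : ℝ × ℝ → ℝ} {L β r s η h : ℝ}
    {x₀ x y : ℤ × ℤ} (hL : 0 ≤ L) (hβ : 0 ≤ β) (hf : LocalHolder N f L β x₀ r)
    (hs : 0 ≤ s) (hsr : s + η ≤ r) (hsh : s ≤ h) (hx : x ∈ evenWindow N x₀ s)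
    (hy : y ∈ matchedPatch N x₀ η x) :
    |f (pos N (x + (y - x₀))) - f (pos N y)| ≤ L * h ^ β := by
  simp only [evenWindow, evenPixels, Finset.mem_inter, Finset.mem_filter, mem_window_iff] at hx
  rw [mem_matchedPatch_iff hx.2.2] at hy
  refine hf.abs_sub_le hL hβ ?_ ?_ ?_
  · refine mem_window_iff.2 ⟨hy.2.1, ?_⟩
    have e : pos N (x + (y - x₀)) - pos N x₀ =
        (pos N x - pos N x₀) + (pos N y - pos N x₀) := by
      rw [← pos_translate_sub N x x₀ y]
      abel
    rw [e]
    linarith [norm_add_le (pos N x - pos N x₀) (pos N y - pos N x₀), hx.1.2, hy.2.2.1]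
  · exact mem_window_iff.2 ⟨hy.1, by linarith [hy.2.2.1]⟩
  · rw [pos_translate_sub]
    exact hx.1.2.trans hsh

/-- From every index one can move into the image in one of the two directions. -/
theorem exists_inward_direction (N i : ℤ) :
    ∃ s : ℤ, |s| = 1 ∧ ∀ v a : ℤ, 1 ≤ i + v → i + v ≤ N → 4 * |v| ≤ N → 0 ≤ a → 4 * a ≤ N →
      1 ≤ i + v + s * a ∧ i + v + s * a ≤ N := by
  -- Move away from the nearer border. The direction depends on `i` alone, so it serves every offset
  -- `v`, hence the patches at `x₀` and at `x` simultaneously.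
  rcases le_or_gt (2 * i) N with h | h
  · exact ⟨1, rfl, fun v a h1 h2 h3 h4 h5 => by
      have := le_abs_self v
      constructor <;> linarith⟩
  · refine ⟨-1, rfl, fun v a h1 h2 h3 h4 h5 => ?_⟩
    have := neg_abs_le v
    constructor <;> omega

/-- Count the pixels reached from `x₀` by even inward steps in both coordinates: a quadrant that
stays in the image even at a corner. -/
theorem le_card_evenWindow {N k : ℕ} (hN : 0 < N) {x₀ : ℤ × ℤ} (hx₀ : x₀ ∈ grid N) {s : ℝ}
    (hk : (k : ℝ) ≤ s * N) (hkN : 4 * k ≤ N) :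
    (k / 2 + 1) * (k / 2 + 1) ≤ (evenWindow N x₀ s).card := by
  rw [mem_grid_iff] at hx₀
  obtain ⟨s₁, hs₁, h₁⟩ := exists_inward_direction N x₀.1
  obtain ⟨s₂, hs₂, h₂⟩ := exists_inward_direction N x₀.2
  have hs₁0 : s₁ ≠ 0 := by rintro rfl; simp at hs₁
  have hs₂0 : s₂ ≠ 0 := by rintro rfl; simp at hs₂
  have hcard : (Finset.range (k / 2 + 1) ×ˢ Finset.range (k / 2 + 1)).card =
      (k / 2 + 1) * (k / 2 + 1) := by simp
  rw [← hcard]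
  refine Finset.card_le_card_of_injOn
    (fun p => (x₀.1 + s₁ * (2 * p.1 : ℤ), x₀.2 + s₂ * (2 * p.2 : ℤ))) ?_ ?_
  · rintro ⟨a, b⟩ hab
    simp only [Finset.coe_product, Finset.coe_range, Set.mem_prod, Set.mem_Iio] at hab
    have ha : 2 * a ≤ k := by omega
    have hb : 2 * b ≤ k := by omega
    have g₁ := h₁ 0 (2 * a) (by omega) (by omega) (by simp) (by omega) (by omega)
    have g₂ := h₂ 0 (2 * b) (by omega) (by omega) (by simp) (by omega) (by omega)
    simp only [add_zero] at g₁ g₂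
    have ha' : (2 * a : ℝ) ≤ k := by exact_mod_cast ha
    have hb' : (2 * b : ℝ) ≤ k := by exact_mod_cast hb
    have hs₁' : |(s₁ : ℝ)| = 1 := by exact_mod_cast hs₁
    have hs₂' : |(s₂ : ℝ)| = 1 := by exact_mod_cast hs₂
    simp only [evenWindow, evenPixels, Finset.coe_inter, Set.mem_inter_iff, Finset.mem_coe,
      Finset.mem_filter, mem_window_iff, norm_pos_sub_le_iff hN, mem_grid_iff]
    refine ⟨⟨⟨g₁, g₂⟩, ?_, ?_⟩, ⟨g₁, g₂⟩, ⟨s₁ * a + s₂ * b, by ring⟩⟩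
    · rw [add_sub_cancel_left]
      push_cast
      rw [abs_mul, hs₁', one_mul, abs_of_nonneg (by positivity)]
      linarith
    · rw [add_sub_cancel_left]
      push_cast
      rw [abs_mul, hs₂', one_mul, abs_of_nonneg (by positivity)]
      linarith
  · rintro ⟨a, b⟩ - ⟨a', b'⟩ - hab
    simp only [Prod.mk.injEq, add_right_inj, mul_eq_mul_left_iff, hs₁0, hs₂0, or_false] at hab
    ext <;> dsimp only <;> omega

/-- An odd inward step in the first coordinate and an even one in the second give an odd pixel;
there are `(k + 1) / 2` and `k / 2 + 1` such steps of length at most `k`. -/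
theorem le_card_matchedPatch {N k l : ℕ} (hN : 0 < N) {x₀ x : ℤ × ℤ} (hx₀ : x₀ ∈ grid N)
    {s η : ℝ} (hx : x ∈ evenWindow N x₀ s) (hl : s * N ≤ l) (hlN : 4 * l ≤ N)
    (hk : (k : ℝ) ≤ η * N) (hkN : 4 * k ≤ N) :
    ((k + 1) / 2) * (k / 2 + 1) ≤ (matchedPatch N x₀ η x).card := by
  rw [mem_grid_iff] at hx₀
  simp only [evenWindow, evenPixels, Finset.mem_inter, Finset.mem_filter, mem_window_iff,
    norm_pos_sub_le_iff hN, mem_grid_iff] at hx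
  obtain ⟨⟨hxg, hx1, hx2⟩, -, hxe⟩ := hx
  have hv1 : |x.1 - x₀.1| ≤ l := by exact_mod_cast hx1.trans hl
  have hv2 : |x.2 - x₀.2| ≤ l := by exact_mod_cast hx2.trans hl
  obtain ⟨s₁, hs₁, h₁⟩ := exists_inward_direction N x₀.1
  obtain ⟨s₂, hs₂, h₂⟩ := exists_inward_direction N x₀.2
  have hs₁0 : s₁ ≠ 0 := by rintro rfl; simp at hs₁
  have hs₂0 : s₂ ≠ 0 := by rintro rfl; simp at hs₂
  have hodd : Odd s₁ := by
    rcases (abs_eq zero_le_one).1 hs₁ with rfl | rfl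
    · exact odd_one
    · exact ⟨-1, rfl⟩
  have hcard : (Finset.range ((k + 1) / 2) ×ˢ Finset.range (k / 2 + 1)).card =
      ((k + 1) / 2) * (k / 2 + 1) := by simp
  rw [← hcard]
  refine Finset.card_le_card_of_injOn
    (fun p => (x₀.1 + s₁ * (2 * p.1 + 1 : ℤ), x₀.2 + s₂ * (2 * p.2 : ℤ))) ?_ ?_
  · rintro ⟨a, b⟩ hab
    simp only [Finset.coe_product, Finset.coe_range, Set.mem_prod, Set.mem_Iio] at hab
    have ha : 2 * a + 1 ≤ k := by omega
    have hb : 2 * b ≤ k := by omega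
    have g₁ := h₁ 0 (2 * a + 1) (by omega) (by omega) (by simp) (by omega) (by omega)
    have g₂ := h₂ 0 (2 * b) (by omega) (by omega) (by simp) (by omega) (by omega)
    have g₃ := h₁ (x.1 - x₀.1) (2 * a + 1) (by omega) (by omega) (by omega) (by omega) (by omega)
    have g₄ := h₂ (x.2 - x₀.2) (2 * b) (by omega) (by omega) (by omega) (by omega) (by omega)
    simp only [add_zero, add_sub_cancel] at g₁ g₂ g₃ g₄
    have ha' : (2 * a + 1 : ℝ) ≤ k := by exact_mod_cast ha
    have hb' : (2 * b : ℝ) ≤ k := by exact_mod_cast hb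
    have hs₁' : |(s₁ : ℝ)| = 1 := by exact_mod_cast hs₁
    have hs₂' : |(s₂ : ℝ)| = 1 := by exact_mod_cast hs₂
    rw [Finset.mem_coe, mem_matchedPatch_iff hxe, norm_pos_sub_le_iff hN]
    simp only [mem_grid_iff, Prod.fst_add, Prod.snd_add, Prod.fst_sub, Prod.snd_sub,
      add_sub_cancel_left]
    refine ⟨⟨g₁, g₂⟩, ⟨g₃, g₄⟩, ⟨?_, ?_⟩, ?_⟩
    · push_cast
      rw [abs_mul, hs₁', one_mul, abs_of_nonneg (by positivity)]
      linarith
    · push_cast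
      rw [abs_mul, hs₂', one_mul, abs_of_nonneg (by positivity)]
      linarith
    · rw [Int.not_even_iff_odd]
      exact (hodd.mul ⟨a, rfl⟩).add_even ((even_two_mul _).mul_left _)
  · rintro ⟨a, b⟩ - ⟨a', b'⟩ - hab
    simp only [Prod.mk.injEq, add_right_inj, mul_eq_mul_left_iff, hs₁0, hs₂0, or_false] at hab
    ext <;> dsimp only <;> omega

theorem sq_le_card_evenWindow {N : ℕ} (hN : 0 < N) {x₀ : ℤ × ℤ} (hx₀ : x₀ ∈ grid N) {s : ℝ}
    (hs : 0 ≤ s) (hs4 : s ≤ 1 / 4) : (s * N) ^ 2 / 4 ≤ (evenWindow N x₀ s).card := by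
  have hs0 : 0 ≤ s * N := by positivity
  have hk : (⌊s * N⌋₊ : ℝ) ≤ s * N := Nat.floor_le hs0
  have hk4 : 4 * ⌊s * N⌋₊ ≤ N := by
    have hN0 : (0 : ℝ) ≤ N := Nat.cast_nonneg N
    have : (4 * ⌊s * N⌋₊ : ℝ) ≤ N := by nlinarith
    exact_mod_cast this
  have h := le_card_evenWindow hN hx₀ hk hk4
  have h1 : s * N ≤ 2 * ((⌊s * N⌋₊ / 2 + 1 : ℕ) : ℝ) := by
    have h2 : ⌊s * N⌋₊ + 1 ≤ 2 * (⌊s * N⌋₊ / 2 + 1) := by omega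
    have h3 : ((⌊s * N⌋₊ : ℝ) + 1) ≤ 2 * ((⌊s * N⌋₊ / 2 + 1 : ℕ) : ℝ) := by exact_mod_cast h2
    linarith [Nat.lt_floor_add_one (s * N)]
  have h' : ((⌊s * N⌋₊ / 2 + 1 : ℕ) : ℝ) * ((⌊s * N⌋₊ / 2 + 1 : ℕ) : ℝ) ≤
      (evenWindow N x₀ s).card := by exact_mod_cast h
  nlinarith

theorem sq_le_card_matchedPatch {N : ℕ} (hN : 0 < N) {x₀ x : ℤ × ℤ} (hx₀ : x₀ ∈ grid N)
    {s t η : ℝ} (hs : 0 ≤ s) (hs4 : s ≤ 1 / 4) (hx : x ∈ evenWindow N x₀ s)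
    (ht : 0 ≤ t) (ht4 : t ≤ 1 / 4) (htη : t ≤ η) (hne : (matchedPatch N x₀ η x).card ≠ 0) :
    (t * N) ^ 2 / 8 ≤ (matchedPatch N x₀ η x).card := by
  have hN0 : (0 : ℝ) ≤ N := Nat.cast_nonneg N
  have hone : (1 : ℝ) ≤ (matchedPatch N x₀ η x).card := by
    exact_mod_cast Nat.one_le_iff_ne_zero.2 hne
  have ht0 : 0 ≤ t * N := by positivity
  -- Below one pixel, nonemptiness alone gives the bound.
  rcases lt_or_ge (t * N) 1 with h1 | h1
  · nlinarith
  have hk : (⌊t * N⌋₊ : ℝ) ≤ t * N := Nat.floor_le ht0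
  have hk4 : 4 * ⌊t * N⌋₊ ≤ N := by
    have : (4 * ⌊t * N⌋₊ : ℝ) ≤ N := by nlinarith
    exact_mod_cast this
  have hk1 : 1 ≤ ⌊t * N⌋₊ := (Nat.one_le_floor_iff _).2 h1
  have hl4 : 4 * ⌊s * N⌋₊ ≤ N := by
    have := Nat.floor_le (show 0 ≤ s * N by positivity)
    have : (4 * ⌊s * N⌋₊ : ℝ) ≤ N := by nlinarith
    exact_mod_cast this
  -- Pixel offsets are integers, so the radius may be rounded down to a multiple of `1 / N`.
  have hx' : x ∈ evenWindow N x₀ (⌊s * N⌋₊ / N : ℝ) := by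
    have hN' : (N : ℝ) ≠ 0 := by exact_mod_cast hN.ne'
    simp only [evenWindow, Finset.mem_inter, mem_window_iff, norm_pos_sub_le_iff hN] at hx ⊢
    rw [div_mul_cancel₀ _ hN']
    refine ⟨⟨hx.1.1, ?_, ?_⟩, hx.2⟩
    · have := hx.1.2.1
      rw [← Int.cast_abs, ← Int.natCast_natAbs, Int.cast_natCast] at this ⊢
      exact_mod_cast Nat.le_floor this
    · have := hx.1.2.2
      rw [← Int.cast_abs, ← Int.natCast_natAbs, Int.cast_natCast] at this ⊢
      exact_mod_cast Nat.le_floor this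
  have h := le_card_matchedPatch hN hx₀ hx'
    (div_mul_cancel₀ _ (by exact_mod_cast hN.ne' : (N : ℝ) ≠ 0)).le hl4
    (hk.trans (mul_le_mul_of_nonneg_right htη hN0)) hk4
  set k := ⌊t * N⌋₊
  have hlt : t * N < k + 1 := Nat.lt_floor_add_one _
  -- Needs `k ≥ 1`; with the next line it produces the constant `8 = 4 * 2`.
  have h2 : k + 1 ≤ 4 * ((k + 1) / 2) := by omega
  have h3 : k + 1 ≤ 2 * (k / 2 + 1) := by omega
  have h4 : (k + 1) * (k + 1) ≤ 8 * (matchedPatch N x₀ η x).card := by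
    calc (k + 1) * (k + 1) ≤ (4 * ((k + 1) / 2)) * (2 * (k / 2 + 1)) := Nat.mul_le_mul h2 h3
      _ = 8 * (((k + 1) / 2) * (k / 2 + 1)) := by ring
      _ ≤ _ := Nat.mul_le_mul_left _ h
  have h5 : ((k : ℝ) + 1) * (k + 1) ≤ 8 * (matchedPatch N x₀ η x).card := by exact_mod_cast h4
  nlinarith

/-! ### Gaussian noise -/

/-- The fourth moment of the noise. -/
def fourthMoment (σ : ℝ) : ℝ := ∫ t, t ^ 4 ∂gaussianReal 0 (σ ^ 2).toNNReal

theorem fourthMoment_nonneg (σ : ℝ) : 0 ≤ fourthMoment σ :=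
  integral_nonneg fun t => by positivity

namespace IsGaussianNoise

variable {Ω : Type*} [MeasurableSpace Ω] {P : Measure Ω} {N : ℕ} {σ : ℝ} {ε : ℤ × ℤ → Ω → ℝ}

theorem aemeasurable (hε : IsGaussianNoise P N σ ε) {x : ℤ × ℤ} (hx : x ∈ grid N) :
    AEMeasurable (ε x) P :=
  (hε.law x hx).aemeasurable

theorem memLp (hε : IsGaussianNoise P N σ ε) {x : ℤ × ℤ} (hx : x ∈ grid N) (p : NNReal) :
    MemLp (ε x) p P := by
  have h := memLp_id_gaussianReal (μ := 0) (v := (σ ^ 2).toNNReal) p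
  rw [← (hε.law x hx).map_eq] at h
  exact (memLp_map_measure_iff h.1 (hε.aemeasurable hx)).1 h

theorem integral_eq_zero (hε : IsGaussianNoise P N σ ε) {x : ℤ × ℤ} (hx : x ∈ grid N) :
    ∫ ω, ε x ω ∂P = 0 := by
  have h := (hε.law x hx).integral_comp (f := fun t => t) (by fun_prop)
  rw [integral_id_gaussianReal] at h
  exact h

theorem integral_pow_four (hε : IsGaussianNoise P N σ ε) {x : ℤ × ℤ} (hx : x ∈ grid N) :
    ∫ ω, ε x ω ^ 4 ∂P = fourthMoment σ :=
  (hε.law x hx).integral_comp (f := fun t => t ^ 4) (by fun_prop)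

theorem integral_sq (hε : IsGaussianNoise P N σ ε) {x : ℤ × ℤ} (hx : x ∈ grid N) :
    ∫ ω, ε x ω ^ 2 ∂P = σ ^ 2 := by
  have h1 : ∫ ω, ε x ω ^ 2 ∂P = ∫ t, t ^ 2 ∂gaussianReal 0 (σ ^ 2).toNNReal :=
    (hε.law x hx).integral_comp (f := fun t => t ^ 2) (by fun_prop)
  have h2 := variance_fun_id_gaussianReal (μ := 0) (v := (σ ^ 2).toNNReal)
  rw [variance_of_integral_eq_zero (by fun_prop) integral_id_gaussianReal,
    Real.coe_toNNReal _ (sq_nonneg σ)] at h2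
  rw [h1, h2]

theorem integrable_mul (hε : IsGaussianNoise P N σ ε) {x y : ℤ × ℤ} (hx : x ∈ grid N)
    (hy : y ∈ grid N) : Integrable (fun ω => ε x ω * ε y ω) P :=
  MemLp.integrable_mul (p := 2) (q := 2) (hε.memLp hx 2) (hε.memLp hy 2)

theorem integrable_sq (hε : IsGaussianNoise P N σ ε) {x : ℤ × ℤ} (hx : x ∈ grid N) :
    Integrable (fun ω => ε x ω ^ 2) P :=
  (hε.memLp hx 2).integrable_sq

theorem integrable_pow_four (hε : IsGaussianNoise P N σ ε) {x : ℤ × ℤ} (hx : x ∈ grid N) :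
    Integrable (fun ω => ε x ω ^ 4) P := by
  have := (hε.memLp hx 4).integrable_norm_pow (p := 4) (by norm_num)
  refine this.congr (ae_of_all _ fun ω => ?_)
  simp [Real.norm_eq_abs, (show Even 4 by decide).pow_abs]

theorem integral_mul_eq_zero (hε : IsGaussianNoise P N σ ε) {x y : ℤ × ℤ} (hx : x ∈ grid N)
    (hy : y ∈ grid N) (hxy : x ≠ y) : ∫ ω, ε x ω * ε y ω ∂P = 0 := by
  have h : IndepFun (ε x) (ε y) P :=
    hε.indep.indepFun (i := ⟨x, hx⟩) (j := ⟨y, hy⟩) (by simpa using hxy)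
  rw [h.integral_fun_mul_eq_mul_integral (hε.aemeasurable hx).aestronglyMeasurable
    (hε.aemeasurable hy).aestronglyMeasurable, hε.integral_eq_zero hx, zero_mul]

theorem aestronglyMeasurable_sq_sub (hε : IsGaussianNoise P N σ ε) {x y : ℤ × ℤ}
    (hx : x ∈ grid N) (hy : y ∈ grid N) :
    AEStronglyMeasurable (fun ω => (ε x ω - ε y ω) ^ 2 - 2 * σ ^ 2) P :=
  (((hε.aemeasurable hx).sub (hε.aemeasurable hy)).pow_const 2).sub_const _
    |>.aestronglyMeasurable

/-- The squared noise differences have mean `2 σ²`. -/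
theorem integral_sq_sub_eq_zero [IsProbabilityMeasure P] (hε : IsGaussianNoise P N σ ε)
    {x y : ℤ × ℤ} (hx : x ∈ grid N) (hy : y ∈ grid N) (hxy : x ≠ y) :
    ∫ ω, ((ε x ω - ε y ω) ^ 2 - 2 * σ ^ 2) ∂P = 0 := by
  have e : ∀ ω, (ε x ω - ε y ω) ^ 2 - 2 * σ ^ 2 =
      (ε x ω ^ 2 + ε y ω ^ 2 - 2 * (ε x ω * ε y ω)) - 2 * σ ^ 2 := fun ω => by ring
  simp_rw [e]
  have i1 := hε.integrable_sq hx
  have i2 := hε.integrable_sq hy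
  have i3 := (hε.integrable_mul hx hy).const_mul 2
  have i12 : Integrable (fun ω => ε x ω ^ 2 + ε y ω ^ 2) P := i1.add i2
  have i123 : Integrable (fun ω => ε x ω ^ 2 + ε y ω ^ 2 - 2 * (ε x ω * ε y ω)) P := i12.sub i3
  rw [integral_sub i123 (integrable_const _), integral_sub i12 i3,
    integral_add i1 i2, integral_const_mul, hε.integral_sq hx, hε.integral_sq hy,
    hε.integral_mul_eq_zero hx hy hxy]
  simp
  ring

/-- The cross term `-4 σ² (a - b)²` is dropped, and `(a - b)⁴ ≤ 4 (a² + b²)² ≤ 8 (a⁴ + b⁴)`. -/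
theorem sq_sq_sub_le (a b σ : ℝ) :
    ((a - b) ^ 2 - 2 * σ ^ 2) ^ 2 ≤ 8 * (a ^ 4 + b ^ 4) + 4 * σ ^ 4 := by
  have h1 : (a - b) ^ 2 ≤ 2 * (a ^ 2 + b ^ 2) := by nlinarith [sq_nonneg (a + b)]
  have h2 : ((a - b) ^ 2) ^ 2 ≤ (2 * (a ^ 2 + b ^ 2)) ^ 2 := by gcongr
  nlinarith [sq_nonneg (a ^ 2 - b ^ 2), mul_nonneg (sq_nonneg (a - b)) (sq_nonneg σ)]

theorem integrable_sq_sq_sub [IsFiniteMeasure P] (hε : IsGaussianNoise P N σ ε) {x y : ℤ × ℤ}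
    (hx : x ∈ grid N) (hy : y ∈ grid N) :
    Integrable (fun ω => ((ε x ω - ε y ω) ^ 2 - 2 * σ ^ 2) ^ 2) P := by
  refine Integrable.mono' ((((hε.integrable_pow_four hx).add
    (hε.integrable_pow_four hy)).const_mul 8).add (integrable_const (4 * σ ^ 4)))
    ((hε.aestronglyMeasurable_sq_sub hx hy).pow 2) (ae_of_all _ fun ω => ?_)
  rw [Real.norm_eq_abs, abs_of_nonneg (sq_nonneg _)]
  exact sq_sq_sub_le _ _ _

theorem integral_sq_sq_sub_le [IsProbabilityMeasure P] (hε : IsGaussianNoise P N σ ε)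
    {x y : ℤ × ℤ} (hx : x ∈ grid N) (hy : y ∈ grid N) :
    ∫ ω, ((ε x ω - ε y ω) ^ 2 - 2 * σ ^ 2) ^ 2 ∂P ≤ 16 * fourthMoment σ + 4 * σ ^ 4 := by
  have i1 := hε.integrable_pow_four hx
  have i2 := hε.integrable_pow_four hy
  have i3 : Integrable (fun ω => 8 * (ε x ω ^ 4 + ε y ω ^ 4)) P := (i1.add i2).const_mul 8
  calc ∫ ω, ((ε x ω - ε y ω) ^ 2 - 2 * σ ^ 2) ^ 2 ∂P
      ≤ ∫ ω, (8 * (ε x ω ^ 4 + ε y ω ^ 4) + 4 * σ ^ 4) ∂P :=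
        integral_mono (hε.integrable_sq_sq_sub hx hy)
          (i3.add (integrable_const _)) fun ω => sq_sq_sub_le _ _ _
    _ = 16 * fourthMoment σ + 4 * σ ^ 4 := by
        rw [integral_add i3 (integrable_const _), integral_const_mul,
          integral_add i1 i2, hε.integral_pow_four hx, hε.integral_pow_four hy]
        simp
        ring

/-- Squared noise differences over disjoint pairs of pixels are uncorrelated. -/
theorem integral_sq_sub_mul_eq_zero [IsProbabilityMeasure P] (hε : IsGaussianNoise P N σ ε)
    {a b c d : ℤ × ℤ} (ha : a ∈ grid N) (hb : b ∈ grid N) (hc : c ∈ grid N) (hd : d ∈ grid N)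
    (hab : a ≠ b) (hac : a ≠ c) (had : a ≠ d) (hbc : b ≠ c) (hbd : b ≠ d) :
    ∫ ω, ((ε a ω - ε b ω) ^ 2 - 2 * σ ^ 2) * ((ε c ω - ε d ω) ^ 2 - 2 * σ ^ 2) ∂P = 0 := by
  have h := hε.indep.indepFun_prodMk_prodMk₀ (fun i => hε.aemeasurable i.2)
    ⟨a, ha⟩ ⟨b, hb⟩ ⟨c, hc⟩ ⟨d, hd⟩ (by simpa using hac) (by simpa using had)
    (by simpa using hbc) (by simpa using hbd)
  have hm : Measurable fun p : ℝ × ℝ => (p.1 - p.2) ^ 2 - 2 * σ ^ 2 := by fun_prop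
  have h2 : IndepFun (fun ω => (ε a ω - ε b ω) ^ 2 - 2 * σ ^ 2)
      (fun ω => (ε c ω - ε d ω) ^ 2 - 2 * σ ^ 2) P := h.comp hm hm
  rw [h2.integral_fun_mul_eq_mul_integral (hε.aestronglyMeasurable_sq_sub ha hb)
    (hε.aestronglyMeasurable_sq_sub hc hd), hε.integral_sq_sub_eq_zero ha hb hab, zero_mul]

end IsGaussianNoise

/-- The second moment of a sum of square integrable functions, each of which is orthogonal to
all but at most `k` others. -/
theorem integral_sq_sum_le {Ω ι : Type*} [MeasurableSpace Ω] {P : Measure Ω} [DecidableEq ι]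
    {M : Finset ι} {X : ι → Ω → ℝ} {nbr : ι → Finset ι} {k : ℕ} {K : ℝ} (hK0 : 0 ≤ K)
    (hX : ∀ y ∈ M, MemLp (X y) 2 P) (hK : ∀ y ∈ M, ∫ ω, X y ω ^ 2 ∂P ≤ K)
    (hnbr : ∀ y ∈ M, (nbr y).card ≤ k)
    (horth : ∀ y ∈ M, ∀ z ∈ M, z ∉ nbr y → ∫ ω, X y ω * X z ω ∂P = 0) :
    ∫ ω, (∑ y ∈ M, X y ω) ^ 2 ∂P ≤ M.card * (k * K) := by
  have hi : ∀ y ∈ M, ∀ z ∈ M, Integrable (fun ω => X y ω * X z ω) P := fun y hy z hz =>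
    MemLp.integrable_mul (hX y hy) (hX z hz)
  simp_rw [sq, Finset.sum_mul_sum]
  rw [integral_finsetSum _ fun y hy => integrable_finsetSum _ fun z hz => hi y hy z hz,
    ← nsmul_eq_mul]
  refine Finset.sum_le_card_nsmul _ _ _ fun y hy => ?_
  rw [integral_finsetSum _ fun z hz => hi y hy z hz]
  have hle : ∀ z ∈ M, ∫ ω, X y ω * X z ω ∂P ≤ K := fun z hz => by
    have h1 := (hX y hy).integrable_sq
    have h2 := (hX z hz).integrable_sq
    calc ∫ ω, X y ω * X z ω ∂P ≤ ∫ ω, (X y ω ^ 2 / 2 + X z ω ^ 2 / 2) ∂P :=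
          integral_mono (hi y hy z hz) ((h1.div_const 2).add (h2.div_const 2)) fun ω => by
            change X y ω * X z ω ≤ X y ω ^ 2 / 2 + X z ω ^ 2 / 2
            nlinarith [sq_nonneg (X y ω - X z ω)]
      _ = (∫ ω, X y ω ^ 2 ∂P) / 2 + (∫ ω, X z ω ^ 2 ∂P) / 2 := by
          rw [integral_add (h1.div_const 2) (h2.div_const 2), integral_div, integral_div]
      _ ≤ K := by linarith [hK y hy, hK z hz]
  calc ∑ z ∈ M, ∫ ω, X y ω * X z ω ∂P
      = ∑ z ∈ M ∩ nbr y, ∫ ω, X y ω * X z ω ∂P := by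
        refine (Finset.sum_subset Finset.inter_subset_left fun z hz hz' => ?_).symm
        exact horth y hy z hz fun h => hz' (Finset.mem_inter.2 ⟨hz, h⟩)
    _ ≤ (M ∩ nbr y).card • K :=
        Finset.sum_le_card_nsmul _ _ _ fun z hz => hle z (Finset.mem_inter.1 hz).1
    _ ≤ k * K := by
        rw [nsmul_eq_mul]
        refine mul_le_mul_of_nonneg_right ?_ hK0
        exact_mod_cast (Finset.card_le_card Finset.inter_subset_right).trans (hnbr y hy)

namespace IsGaussianNoise

variable {Ω : Type*} [MeasurableSpace Ω] {P : Measure Ω} {N : ℕ} {σ : ℝ} {ε : ℤ × ℤ → Ω → ℝ}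

theorem noiseDistSq_sub_eq {x₀ x : ℤ × ℤ} {η : ℝ} (hm : (matchedPatch N x₀ η x).card ≠ 0)
    (e : ℤ × ℤ → ℝ) : noiseDistSq N x₀ η e x - 2 * σ ^ 2 =
      (∑ y ∈ matchedPatch N x₀ η x, ((e (x + (y - x₀)) - e y) ^ 2 - 2 * σ ^ 2)) /
        (matchedPatch N x₀ η x).card := by
  have : ((matchedPatch N x₀ η x).card : ℝ) ≠ 0 := by exact_mod_cast hm
  rw [noiseDistSq, Finset.sum_sub_distrib, Finset.sum_const, nsmul_eq_mul]
  field_simp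

theorem mem_grid_of_mem_matchedPatch {x₀ x y : ℤ × ℤ} {η : ℝ}
    (hy : y ∈ matchedPatch N x₀ η x) : y ∈ grid N ∧ x + (y - x₀) ∈ grid N := by
  simp only [matchedPatch, oddPatch, Finset.mem_filter, Finset.mem_inter, mem_window_iff] at hy
  exact ⟨hy.1.1.1, hy.2.1.1⟩

theorem memLp_sq_sub [IsFiniteMeasure P] (hε : IsGaussianNoise P N σ ε) {x y : ℤ × ℤ}
    (hx : x ∈ grid N) (hy : y ∈ grid N) :
    MemLp (fun ω => (ε x ω - ε y ω) ^ 2 - 2 * σ ^ 2) 2 P :=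
  (memLp_two_iff_integrable_sq (hε.aestronglyMeasurable_sq_sub hx hy)).2
    (hε.integrable_sq_sq_sub hx hy)

theorem integrable_sq_noiseDistSq_sub [IsFiniteMeasure P] (hε : IsGaussianNoise P N σ ε)
    {x₀ x : ℤ × ℤ} {η : ℝ} (hm : (matchedPatch N x₀ η x).card ≠ 0) :
    Integrable (fun ω => (noiseDistSq N x₀ η (fun y => ε y ω) x - 2 * σ ^ 2) ^ 2) P := by
  have h : MemLp (fun ω => ∑ y ∈ matchedPatch N x₀ η x,
      ((ε (x + (y - x₀)) ω - ε y ω) ^ 2 - 2 * σ ^ 2)) 2 P :=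
    memLp_finsetSum _ fun y hy =>
      hε.memLp_sq_sub (mem_grid_of_mem_matchedPatch hy).2 (mem_grid_of_mem_matchedPatch hy).1
  simp_rw [noiseDistSq_sub_eq hm, div_pow]
  exact h.integrable_sq.div_const _

/-- The normalized squared distance of the noise patches concentrates around `2 σ²`. -/
theorem integral_sq_noiseDistSq_sub_le [IsProbabilityMeasure P] (hε : IsGaussianNoise P N σ ε)
    {x₀ x : ℤ × ℤ} {η : ℝ} (hx : x ≠ x₀) (hm : (matchedPatch N x₀ η x).card ≠ 0) :
    ∫ ω, (noiseDistSq N x₀ η (fun y => ε y ω) x - 2 * σ ^ 2) ^ 2 ∂P ≤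
      3 * (16 * fourthMoment σ + 4 * σ ^ 4) / (matchedPatch N x₀ η x).card := by
  set M := matchedPatch N x₀ η x with hM
  set K := 16 * fourthMoment σ + 4 * σ ^ 4 with hKdef
  have hK0 : 0 ≤ K := by
    have := fourthMoment_nonneg σ
    positivity
  have hg : ∀ y ∈ M, y ∈ grid N ∧ x + (y - x₀) ∈ grid N := fun y hy =>
    mem_grid_of_mem_matchedPatch hy
  have hne : ∀ y : ℤ × ℤ, x + (y - x₀) ≠ y := fun y h => hx <| by
    have h1 : x - x₀ = x + (y - x₀) - y := by abel
    rw [← sub_eq_zero, h1, h, sub_self]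
  -- The pairs `{y, y + (x - x₀)}` and `{z, z + (x - x₀)}` meet only if `z` is `y` or `y ± (x -
  -- x₀)`, whence `k = 3`.
  have hsum := integral_sq_sum_le (P := P) (M := M) (k := 3) (K := K)
    (X := fun y ω => (ε (x + (y - x₀)) ω - ε y ω) ^ 2 - 2 * σ ^ 2)
    (nbr := fun y => {y, x + (y - x₀), y - (x - x₀)}) hK0
    (fun y hy => hε.memLp_sq_sub (hg y hy).2 (hg y hy).1)
    (fun y hy => hε.integral_sq_sq_sub_le (hg y hy).2 (hg y hy).1)
    (fun y _ => Finset.card_le_three)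
    (fun y hy z hz hyz => by
      simp only [Finset.mem_insert, Finset.mem_singleton, not_or] at hyz
      refine hε.integral_sq_sub_mul_eq_zero (hg y hy).2 (hg y hy).1 (hg z hz).2 (hg z hz).1
        (hne y) (fun h => hyz.1 ?_) (fun h => hyz.2.1 h.symm) (fun h => hyz.2.2 ?_)
        (fun h => hyz.1 h.symm)
      · simpa using h.symm
      · rw [h]
        abel)
  have hc : (0 : ℝ) < M.card := by exact_mod_cast Nat.pos_of_ne_zero hm
  simp_rw [noiseDistSq_sub_eq hm, div_pow]
  rw [integral_div, div_le_div_iff₀ (by positivity) hc]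
  calc _ ≤ (M.card * ((3 : ℕ) * K)) * M.card := mul_le_mul_of_nonneg_right hsum hc.le
    _ = _ := by push_cast; ring

/-- Functions of the odd data are independent of the even data. -/
theorem indepFun_odd_even (hε : IsGaussianNoise P N σ ε) {x₀ : ℤ × ℤ}
    {Φ : (ℤ × ℤ → ℝ) → ℝ} (hΦ : Measurable Φ)
    (hodd : ∀ e e' : ℤ × ℤ → ℝ, (∀ y ∈ oddPixels N x₀, e y = e' y) → Φ e = Φ e')
    {x x' : ℤ × ℤ} (hx : x ∈ evenPixels N x₀) (hx' : x' ∈ evenPixels N x₀) :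
    AEMeasurable (fun ω => Φ fun y => ε y ω) P ∧
      IndepFun (fun ω => Φ fun y => ε y ω) (fun ω => ε x ω * ε x' ω) P := by
  have hsub : ∀ y ∈ oddPixels N x₀, y ∈ grid N := fun y hy => (Finset.mem_sdiff.1 hy).1
  have hsub' : ∀ y ∈ evenPixels N x₀, y ∈ grid N := fun y hy => (Finset.mem_filter.1 hy).1
  let S : Finset {y // y ∈ grid N} := Finset.univ.filter fun y => (y : ℤ × ℤ) ∈ oddPixels N x₀
  let T : Finset {y // y ∈ grid N} := Finset.univ.filter fun y => (y : ℤ × ℤ) ∈ evenPixels N x₀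
  have hST : Disjoint S T := by
    rw [Finset.disjoint_left]
    intro y hy hy'
    simp only [S, T, Finset.mem_filter, Finset.mem_univ, true_and] at hy hy'
    exact (Finset.mem_sdiff.1 hy).2 hy'
  have hind := hε.indep.indepFun_finset₀ S T hST fun i => hε.aemeasurable i.2
  -- Extension of the odd values by zero; `Φ` ignores the filled-in values, so it factors through
  -- the odd noise.
  let ext : (S → ℝ) → ℤ × ℤ → ℝ := fun o y =>
    if h : y ∈ oddPixels N x₀ then o ⟨⟨y, hsub y h⟩, by simp [S, h]⟩ else 0
  have hext : Measurable ext := by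
    refine measurable_pi_iff.2 fun y => ?_
    by_cases h : y ∈ oddPixels N x₀
    · simp only [ext, h, dif_pos]
      exact measurable_pi_apply _
    · simp only [ext, h, dif_neg, not_false_eq_true]
      exact measurable_const
  have hfac : (fun ω => Φ fun y => ε y ω) = (Φ ∘ ext) ∘ fun ω (i : S) => ε i ω := by
    funext ω
    refine hodd _ _ fun y hy => ?_
    simp [ext, hy]
  have hprod : Measurable fun t : T → ℝ =>
      t ⟨⟨x, hsub' x hx⟩, by simp [T, hx]⟩ * t ⟨⟨x', hsub' x' hx'⟩, by simp [T, hx']⟩ := by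
    fun_prop
  rw [hfac]
  refine ⟨(hΦ.comp hext).comp_aemeasurable
    (aemeasurable_pi_iff.2 fun i => hε.aemeasurable i.1.2), ?_⟩
  exact hind.comp (hΦ.comp hext) hprod

/-- Averaging the even noise with weights computed from the odd data. -/
theorem integral_sq_sum_weights [IsProbabilityMeasure P] (hε : IsGaussianNoise P N σ ε)
    {x₀ : ℤ × ℤ} {U : Finset (ℤ × ℤ)} (hU : U ⊆ evenPixels N x₀)
    {w : ℤ × ℤ → (ℤ × ℤ → ℝ) → ℝ} (hw : ∀ x ∈ U, Measurable (w x))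
    (hodd : ∀ x ∈ U, ∀ e e' : ℤ × ℤ → ℝ, (∀ y ∈ oddPixels N x₀, e y = e' y) → w x e = w x e')
    (hw1 : ∀ x ∈ U, ∀ e, |w x e| ≤ 1) :
    Integrable (fun ω => (∑ x ∈ U, w x (fun y => ε y ω) * ε x ω) ^ 2) P ∧
    Integrable (fun ω => ∑ x ∈ U, w x (fun y => ε y ω) ^ 2) P ∧
    ∫ ω, (∑ x ∈ U, w x (fun y => ε y ω) * ε x ω) ^ 2 ∂P =
      σ ^ 2 * ∫ ω, ∑ x ∈ U, w x (fun y => ε y ω) ^ 2 ∂P := by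
  have hgrid : ∀ x ∈ U, x ∈ grid N := fun x hx => (Finset.mem_filter.1 (hU hx)).1
  have hind : ∀ x ∈ U, ∀ z ∈ U,
      AEMeasurable (fun ω => w x (fun y => ε y ω) * w z (fun y => ε y ω)) P ∧
      IndepFun (fun ω => w x (fun y => ε y ω) * w z (fun y => ε y ω))
        (fun ω => ε x ω * ε z ω) P := fun x hx z hz =>
    hε.indepFun_odd_even (Φ := fun e => w x e * w z e) ((hw x hx).mul (hw z hz))
      (fun e e' h => by rw [hodd x hx e e' h, hodd z hz e e' h]) (hU hx) (hU hz)
  have hwi : ∀ x ∈ U, ∀ z ∈ U,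
      Integrable (fun ω => w x (fun y => ε y ω) * w z (fun y => ε y ω)) P := fun x hx z hz => by
    refine Integrable.of_bound (hind x hx z hz).1.aestronglyMeasurable 1 (ae_of_all _ fun ω => ?_)
    rw [Real.norm_eq_abs, abs_mul]
    exact mul_le_one₀ (hw1 x hx _) (abs_nonneg _) (hw1 z hz _)
  have hint : ∀ x ∈ U, ∀ z ∈ U, Integrable
      (fun ω => (w x (fun y => ε y ω) * w z (fun y => ε y ω)) * (ε x ω * ε z ω)) P :=
    fun x hx z hz => (hind x hx z hz).2.integrable_mul (hwi x hx z hz)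
      (hε.integrable_mul (hgrid x hx) (hgrid z hz))
  have e : ∀ ω, (∑ x ∈ U, w x (fun y => ε y ω) * ε x ω) ^ 2 = ∑ x ∈ U, ∑ z ∈ U,
      (w x (fun y => ε y ω) * w z (fun y => ε y ω)) * (ε x ω * ε z ω) := fun ω => by
    rw [sq, Finset.sum_mul_sum]
    exact Finset.sum_congr rfl fun x _ => Finset.sum_congr rfl fun z _ => by ring
  simp_rw [e]
  have hw2 : ∀ x ∈ U, Integrable (fun ω => w x (fun y => ε y ω) ^ 2) P := fun x hx => by
    simpa only [sq] using hwi x hx x hx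
  refine ⟨integrable_finsetSum _ fun x hx => integrable_finsetSum _ fun z hz => hint x hx z hz,
    integrable_finsetSum _ hw2, ?_⟩
  rw [integral_finsetSum _ fun x hx => integrable_finsetSum _ fun z hz => hint x hx z hz,
    integral_finsetSum _ hw2, Finset.mul_sum]
  refine Finset.sum_congr rfl fun x hx => ?_
  rw [integral_finsetSum _ fun z hz => hint x hx z hz]
  have hprod : ∀ z ∈ U, ∫ ω, (w x (fun y => ε y ω) * w z (fun y => ε y ω)) * (ε x ω * ε z ω) ∂P =
      (∫ ω, w x (fun y => ε y ω) * w z (fun y => ε y ω) ∂P) * ∫ ω, ε x ω * ε z ω ∂P :=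
    fun z hz => (hind x hx z hz).2.integral_fun_mul_eq_mul_integral
      (hind x hx z hz).1.aestronglyMeasurable
      (hε.integrable_mul (hgrid x hx) (hgrid z hz)).aestronglyMeasurable
  -- Off the diagonal the weights decouple from the noise, whose product has mean zero.
  rw [Finset.sum_eq_single_of_mem x hx fun z hz hzx => by
    rw [hprod z hz, hε.integral_mul_eq_zero (hgrid x hx) (hgrid z hz) hzx.symm, mul_zero]]
  rw [hprod x hx]
  simp_rw [← sq]
  rw [hε.integral_sq (hgrid x hx), mul_comm]

end IsGaussianNoise

/-! ### The risk of the filter -/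

section Risk

variable {Ω : Type*} [MeasurableSpace Ω] {P : Measure Ω} [IsProbabilityMeasure P] {N : ℕ} {σ : ℝ}
  {ε : ℤ × ℤ → Ω → ℝ}

/-- An integrable majorant suffices for the variance bound. The cases `x = x₀` and empty patch,
where the variance bound for the noise distance is not available, have `rhoHat = 0`; the constant is
`24 = 3 * 8`. -/
theorem exists_rhoHat_sq_le (hε : IsGaussianNoise P N σ ε) (hσ : 0 < σ) (hN : 0 < N)
    {f : ℝ × ℝ → ℝ} {x₀ x : ℤ × ℤ} (hx₀ : x₀ ∈ grid N) {η s t A : ℝ} (hA : 0 ≤ A) (hs : 0 ≤ s)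
    (hs4 : s ≤ 1 / 4) (ht : 0 < t) (ht4 : t ≤ 1 / 4) (htη : t ≤ η) (hx : x ∈ evenWindow N x₀ s)
    (hf : ∀ y ∈ matchedPatch N x₀ η x, |f (pos N (x + (y - x₀))) - f (pos N y)| ≤ A) :
    ∃ G : Ω → ℝ, Integrable G P ∧
      (∀ ω, rhoHat N σ x₀ η (observation N f ε ω) x ^ 2 ≤ G ω) ∧
      ∫ ω, G ω ∂P ≤
        2 * A ^ 2 + 24 * (16 * fourthMoment σ + 4 * σ ^ 4) / (σ ^ 2 * (t * N) ^ 2) := by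
  have hK : 0 ≤ 16 * fourthMoment σ + 4 * σ ^ 4 := by
    have := fourthMoment_nonneg σ
    positivity
  by_cases h0 : x = x₀ ∨ (matchedPatch N x₀ η x).card = 0
  · refine ⟨fun _ => 0, integrable_zero _ _ _, fun ω => ?_, ?_⟩
    · rcases h0 with rfl | h0
      · simp [rhoHat_self hσ]
      · simp [rhoHat_eq_zero_of_card hσ h0]
    · rw [integral_zero]
      positivity
  · rw [not_or] at h0
    have hi := hε.integrable_sq_noiseDistSq_sub h0.2
    refine ⟨fun ω => 2 * A ^ 2 + (noiseDistSq N x₀ η (fun y => ε y ω) x - 2 * σ ^ 2) ^ 2 / σ ^ 2,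
      (integrable_const _).add (hi.div_const _),
      fun ω => rhoHat_sq_le (g := fun y => f (pos N y)) (e := fun y => ε y ω) hσ hA hf, ?_⟩
    rw [integral_add (integrable_const _) (hi.div_const _), integral_div]
    simp only [integral_const, probReal_univ, one_smul]
    have hN' : (0 : ℝ) < N := by exact_mod_cast hN
    have h1 := hε.integral_sq_noiseDistSq_sub_le h0.1 h0.2
    have h2 := sq_le_card_matchedPatch hN hx₀ hs hs4 hx ht.le ht4 htη h0.2
    have h3 : 3 * (16 * fourthMoment σ + 4 * σ ^ 4) / (matchedPatch N x₀ η x).card ≤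
        3 * (16 * fourthMoment σ + 4 * σ ^ 4) / ((t * N) ^ 2 / 8) := by
      gcongr
    have h4 := div_le_div_of_nonneg_right (h1.trans h3) (sq_nonneg σ)
    refine add_le_add le_rfl (h4.trans_eq ?_)
    field_simp
    ring

/-- The bias-variance bound for the risk of the split-sample filter. -/
theorem integral_sq_filterEstimate_sub_le (hε : IsGaussianNoise P N σ ε) (hσ : 0 < σ) (hN : 0 < N)
    {f : ℝ × ℝ → ℝ} {x₀ : ℤ × ℤ} (hx₀ : x₀ ∈ grid N) {L β h η r s t : ℝ} (hL : 0 ≤ L)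
    (hβ : 0 ≤ β) (hf : LocalHolder N f L β x₀ r) (hs : 0 < s) (hs4 : s ≤ 1 / 4) (ht : 0 < t)
    (ht4 : t ≤ 1 / 4) (htη : t ≤ η) (hsh : s ≤ h) (hhr : h ≤ r) (hsr : s + η ≤ r) :
    Integrable (fun ω => (filterEstimate N σ h η x₀ (observation N f ε ω) -
        f (pos N x₀)) ^ 2) P ∧
      ∫ ω, (filterEstimate N σ h η x₀ (observation N f ε ω) - f (pos N x₀)) ^ 2 ∂P ≤
        6 * (L * h ^ β) ^ 2 +
          48 * (16 * fourthMoment σ + 4 * σ ^ 4) / (σ ^ 2 * (t * N) ^ 2) +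
          8 * σ ^ 2 / (s * N) ^ 2 := by
  have hN' : (0 : ℝ) < N := by exact_mod_cast hN
  set A := L * h ^ β with hAdef
  have hA : 0 ≤ A := mul_nonneg hL (Real.rpow_nonneg (hs.le.trans hsh) _)
  set U := evenWindow N x₀ h with hU
  set S := evenWindow N x₀ s with hS
  have hSU : S ⊆ U := evenWindow_subset hsh
  have hSc := sq_le_card_evenWindow hN hx₀ hs.le hs4
  have hSpos : (0 : ℝ) < S.card := lt_of_lt_of_le (by positivity) hSc
  have hSne : S.Nonempty := Finset.card_pos.1 (by exact_mod_cast hSpos)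
  have hUeven : U ⊆ evenPixels N x₀ := Finset.inter_subset_right
  have hUgrid : ∀ x ∈ U, x ∈ grid N := fun x hx => (Finset.mem_filter.1 (hUeven hx)).1
  -- The weights as functions of the noise, with `f` fixed.
  let w : ℤ × ℤ → (ℤ × ℤ → ℝ) → ℝ := fun x e =>
    optimalWeight U σ (rhoHat N σ x₀ η fun y => f (pos N y) + e y) x
  have hopt : ∀ e, IsOptimalWeight U σ (rhoHat N σ x₀ η fun y => f (pos N y) + e y)
      (fun x => w x e) := fun e => isOptimalWeight_optimalWeight U (hSne.mono hSU) σ _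
  have hwm : ∀ x ∈ U, Measurable (w x) := fun x hx => by
    refine ((continuous_optimalWeight hσ hx).comp (continuous_pi fun z => ?_)).measurable
    exact (continuous_rhoHat N σ x₀ η z).comp
      (continuous_pi fun y => continuous_const.add (continuous_apply y))
  have hwodd : ∀ x ∈ U, ∀ e e' : ℤ × ℤ → ℝ, (∀ y ∈ oddPixels N x₀, e y = e' y) →
      w x e = w x e' := fun x _ e e' he => by
    simp only [w]
    rw [rhoHat_congr fun y hy => by rw [he y hy]]
  have hw1 : ∀ x ∈ U, ∀ e, |w x e| ≤ 1 := fun x hx e => by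
    rw [abs_of_nonneg ((hopt e).1.1 x hx)]
    exact (hopt e).1.le_one hx
  obtain ⟨hV, hW, hVW⟩ := hε.integral_sq_sum_weights hUeven hwm hwodd hw1
  choose! G hGi hGle hGint using fun x (hx : x ∈ S) =>
    exists_rhoHat_sq_le hε hσ hN hx₀ hA hs.le hs4 ht ht4 htη hx fun y hy =>
      hf.abs_translate_sub_le hL hβ hs.le hsr hsh hx hy
  set B := 2 * A ^ 2 + 24 * (16 * fourthMoment σ + 4 * σ ^ 4) / (σ ^ 2 * (t * N) ^ 2) with hB
  have hGsum : Integrable (fun ω => ∑ x ∈ S, G x ω) P := integrable_finsetSum _ hGi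
  -- the variance term
  have hvar : ∫ ω, (∑ x ∈ U, w x (fun y => ε y ω) * ε x ω) ^ 2 ∂P ≤
      B + 4 * σ ^ 2 / (s * N) ^ 2 := by
    rw [hVW, ← integral_const_mul]
    calc ∫ ω, σ ^ 2 * ∑ x ∈ U, w x (fun y => ε y ω) ^ 2 ∂P
        ≤ ∫ ω, ((∑ x ∈ S, G x ω) / S.card + σ ^ 2 / S.card) ∂P := by
          refine integral_mono (hW.const_mul _)
            ((hGsum.div_const _).add (integrable_const _)) fun ω => ?_
          refine ((hopt fun y => ε y ω).sum_sq_le hSU hSne).trans ?_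
          gcongr with x hx
          exact hGle x hx ω
      _ = (∑ x ∈ S, ∫ ω, G x ω ∂P) / S.card + σ ^ 2 / S.card := by
          rw [integral_add (hGsum.div_const _) (integrable_const _), integral_div,
            integral_finsetSum _ hGi]
          simp
      _ ≤ B + σ ^ 2 / ((s * N) ^ 2 / 4) := by
          refine add_le_add ?_ (by gcongr)
          rw [div_le_iff₀ hSpos, mul_comm, ← nsmul_eq_mul]
          exact Finset.sum_le_card_nsmul _ _ _ hGint
      _ = B + 4 * σ ^ 2 / (s * N) ^ 2 := by
          field_simp
  -- the decomposition into bias and noise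
  have hx₀w : x₀ ∈ window N x₀ r := mem_window_iff.2 ⟨hx₀, by simpa using by linarith⟩
  have hbias : ∀ ω, |∑ x ∈ U, w x (fun y => ε y ω) * (f (pos N x) - f (pos N x₀))| ≤ A :=
    fun ω => (hopt fun y => ε y ω).1.abs_sum_mul_le fun x hx => by
      have hx' := (mem_window_iff.1 (Finset.mem_inter.1 hx).1)
      exact hf.abs_sub_le hL hβ (mem_window_iff.2 ⟨hx'.1, hx'.2.trans hhr⟩) hx₀w hx'.2
  have hdec : ∀ ω, filterEstimate N σ h η x₀ (observation N f ε ω) - f (pos N x₀) =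
      ∑ x ∈ U, w x (fun y => ε y ω) * (f (pos N x) - f (pos N x₀)) +
        ∑ x ∈ U, w x (fun y => ε y ω) * ε x ω := fun ω => by
    have h1 := (hopt fun y => ε y ω).1.2
    have h2 : f (pos N x₀) = ∑ x ∈ U, w x (fun y => ε y ω) * f (pos N x₀) := by
      rw [← Finset.sum_mul, h1, one_mul]
    have h3 : filterEstimate N σ h η x₀ (observation N f ε ω) =
        ∑ x ∈ U, w x (fun y => ε y ω) * (f (pos N x) + ε x ω) := rfl
    rw [h3]
    conv_lhs => rw [h2]
    rw [← Finset.sum_sub_distrib, ← Finset.sum_add_distrib]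
    exact Finset.sum_congr rfl fun x _ => by ring
  have hle : ∀ ω, (filterEstimate N σ h η x₀ (observation N f ε ω) - f (pos N x₀)) ^ 2 ≤
      2 * A ^ 2 + 2 * (∑ x ∈ U, w x (fun y => ε y ω) * ε x ω) ^ 2 := fun ω => by
    rw [hdec ω]
    set b := ∑ x ∈ U, w x (fun y => ε y ω) * (f (pos N x) - f (pos N x₀))
    set v := ∑ x ∈ U, w x (fun y => ε y ω) * ε x ω
    have : b ^ 2 ≤ A ^ 2 := sq_le_sq' (abs_le.1 (hbias ω)).1 (abs_le.1 (hbias ω)).2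
    nlinarith [sq_nonneg (b - v)]
  have hbound : Integrable (fun ω =>
      2 * A ^ 2 + 2 * (∑ x ∈ U, w x (fun y => ε y ω) * ε x ω) ^ 2) P :=
    (integrable_const _).add (hV.const_mul 2)
  have hmeas : AEStronglyMeasurable (fun ω =>
      (filterEstimate N σ h η x₀ (observation N f ε ω) - f (pos N x₀)) ^ 2) P := by
    refine (((Finset.aemeasurable_fun_sum _ fun x hx => ?_).sub_const _).pow_const 2
      ).aestronglyMeasurable
    exact (hε.indepFun_odd_even (hwm x hx) (hwodd x hx) (hUeven hx) (hUeven hx)).1.mul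
      ((hε.aemeasurable (hUgrid x hx)).const_add _)
  have hint : Integrable (fun ω =>
      (filterEstimate N σ h η x₀ (observation N f ε ω) - f (pos N x₀)) ^ 2) P :=
    hbound.mono' hmeas (ae_of_all _ fun ω => by
      rw [Real.norm_eq_abs, abs_of_nonneg (sq_nonneg _)]
      exact hle ω)
  refine ⟨hint, ?_⟩
  calc ∫ ω, (filterEstimate N σ h η x₀ (observation N f ε ω) - f (pos N x₀)) ^ 2 ∂P
      ≤ ∫ ω, (2 * A ^ 2 + 2 * (∑ x ∈ U, w x (fun y => ε y ω) * ε x ω) ^ 2) ∂P :=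
        integral_mono hint hbound hle
    _ = 2 * A ^ 2 + 2 * ∫ ω, (∑ x ∈ U, w x (fun y => ε y ω) * ε x ω) ^ 2 ∂P := by
        rw [integral_add (integrable_const _) (hV.const_mul 2)]
        simp [integral_const_mul]
    _ ≤ 2 * A ^ 2 + 2 * (B + 4 * σ ^ 2 / (s * N) ^ 2) := by gcongr
    _ = _ := by
        rw [hB]
        ring

end Risk

/-! ### Choice of the radii and the rate in `n` -/

theorem cZero_nonneg (L β σ : ℝ) (hβ : 0 ≤ β) : 0 ≤ cZero L β σ :=
  Real.rpow_nonneg (by positivity) _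

end

end OptimalWeights

theorem theorem3 (L β σ c₁ c₂ c₃ : ℝ) (hL : 0 < L) (hβ : 0 < β) (hσ : 0 < σ)
    (hc₁ : OptimalWeights.cZero L β σ < c₁) (hc₂ : 0 < c₂) (hc₁₃ : c₁ ≤ c₃) (hc₂₃ : c₂ < c₃) :
    ∃ C : ℝ, 0 < C ∧
      ∀ (N n : ℕ), 2 ≤ N → n = N ^ 2 →
      ∀ (h η : ℝ), h = c₁ * (n : ℝ) ^ (-(1 / (2 * β + 2))) →
        η = c₂ * (n : ℝ) ^ (-(1 / (2 * β + 2))) →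
      ∀ (f : ℝ × ℝ → ℝ) (x₀ : ℤ × ℤ), x₀ ∈ OptimalWeights.grid N →
        OptimalWeights.LocalHolder N f L β x₀ (c₃ * (n : ℝ) ^ (-(1 / (2 * β + 2)))) →
      ∀ (Ω : Type*) [MeasurableSpace Ω] (P : Measure Ω) [IsProbabilityMeasure P]
        (ε : ℤ × ℤ → Ω → ℝ), OptimalWeights.IsGaussianNoise P N σ ε →
        Integrable (fun ω => (OptimalWeights.filterEstimate N σ h η x₀
            (OptimalWeights.observation N f ε ω) - f (OptimalWeights.pos N x₀)) ^ 2) P ∧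
        ∫ ω, (OptimalWeights.filterEstimate N σ h η x₀
            (OptimalWeights.observation N f ε ω) - f (OptimalWeights.pos N x₀)) ^ 2 ∂P
          ≤ C * ((n : ℝ) ^ (-(2 * β / (2 * β + 2))) * Real.log n) := by
  have hc₁0 : 0 < c₁ := (OptimalWeights.cZero_nonneg L β σ hβ.le).trans_lt hc₁
  set K := 16 * OptimalWeights.fourthMoment σ + 4 * σ ^ 4 with hK
  have hK0 : 0 ≤ K := by
    have := OptimalWeights.fourthMoment_nonneg σ
    positivity
  -- The comparison window has radius `a * u`, with `u` the common scale. The strict inequality `c₂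
  -- < c₃` leaves room for `a > 0`; as `u ≤ 1`, the bound `1 / 4` passes to the radius.
  obtain ⟨a, ha0, ha4, hac₁, hac₃⟩ : ∃ a : ℝ, 0 < a ∧ a ≤ 1 / 4 ∧ a ≤ c₁ ∧ a + c₂ ≤ c₃ := by
    refine ⟨min (1 / 4) (min c₁ (c₃ - c₂)), ?_, min_le_left _ _,
      (min_le_right _ _).trans (min_le_left _ _), ?_⟩
    · exact lt_min (by norm_num) (lt_min hc₁0 (by linarith))
    · have := (min_le_right (1 / 4) (min c₁ (c₃ - c₂))).trans (min_le_right _ _)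
      linarith
  obtain ⟨b, hb0, hb4, hbc₂⟩ : ∃ b : ℝ, 0 < b ∧ b ≤ 1 / 4 ∧ b ≤ c₂ :=
    ⟨min (1 / 4) c₂, lt_min (by norm_num) hc₂, min_le_left _ _, min_le_right _ _⟩
  refine ⟨6 * (L * c₁ ^ β) ^ 2 + 48 * K / (σ ^ 2 * b ^ 2) + 8 * σ ^ 2 / a ^ 2, by positivity, ?_⟩
  intro N n hN hn h η hh hη f x₀ hx₀ hf Ω _ P _ ε hε
  have hn4 : (4 : ℝ) ≤ n := by
    have : 4 ≤ n := by
      rw [hn]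
      nlinarith
    exact_mod_cast this
  have hn0 : (0 : ℝ) < n := by linarith
  set u := (n : ℝ) ^ (-(1 / (2 * β + 2))) with hu
  set q := (n : ℝ) ^ (-(2 * β / (2 * β + 2))) with hq
  have hu0 : 0 < u := Real.rpow_pos_of_pos hn0 _
  have hq0 : 0 < q := Real.rpow_pos_of_pos hn0 _
  have hu1 : u ≤ 1 := Real.rpow_le_one_of_one_le_of_nonpos (by linarith) (by
    rw [neg_nonpos]
    positivity)
  have huβ : (u ^ β) ^ 2 = q := by
    rw [hu, hq, ← Real.rpow_mul hn0.le, ← Real.rpow_natCast, ← Real.rpow_mul hn0.le]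
    congr 1
    push_cast
    ring
  -- Bandwidth balance: the number of pixels in a window of radius `u` has the order of the inverse
  -- squared bias.
  have huN : u ^ 2 * (N : ℝ) ^ 2 = q⁻¹ := by
    have hnN : ((N : ℝ) ^ 2) = (n : ℝ) ^ (1 : ℝ) := by
      rw [Real.rpow_one, hn]
      push_cast
      rfl
    rw [hnN, hu, hq, ← Real.rpow_natCast, ← Real.rpow_mul hn0.le, ← Real.rpow_add hn0,
      ← Real.rpow_neg hn0.le]
    congr 1
    field_simp
    push_cast
    ring
  -- As `n ≥ 4 > e`, the bound by a multiple of `q` implies the one with the logarithm.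
  have hlog : 1 ≤ Real.log n := by
    rw [Real.le_log_iff_exp_le hn0]
    linarith [Real.exp_one_lt_d9]
  have key := OptimalWeights.integral_sq_filterEstimate_sub_le hε hσ (by omega : 0 < N) hx₀
    (h := h) (η := η) (s := a * u) (t := b * u) hL.le hβ.le hf (by positivity) (by nlinarith)
    (by positivity) (by nlinarith) (hη ▸ mul_le_mul_of_nonneg_right hbc₂ hu0.le)
    (hh ▸ mul_le_mul_of_nonneg_right hac₁ hu0.le)
    (hh ▸ mul_le_mul_of_nonneg_right hc₁₃ hu0.le) (by
      rw [hη, ← add_mul]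
      exact mul_le_mul_of_nonneg_right hac₃ hu0.le)
  refine ⟨key.1, key.2.trans ?_⟩
  have e1 : (L * h ^ β) ^ 2 = (L * c₁ ^ β) ^ 2 * q := by
    rw [hh, Real.mul_rpow hc₁0.le hu0.le, ← huβ]
    ring
  have e2 : ∀ c : ℝ, (c * u * N) ^ 2 = c ^ 2 * q⁻¹ := fun c => by
    rw [← huN]
    ring
  rw [e1, e2, e2]
  calc 6 * ((L * c₁ ^ β) ^ 2 * q) + 48 * K / (σ ^ 2 * (b ^ 2 * q⁻¹)) +
        8 * σ ^ 2 / (a ^ 2 * q⁻¹)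
      = (6 * (L * c₁ ^ β) ^ 2 + 48 * K / (σ ^ 2 * b ^ 2) + 8 * σ ^ 2 / a ^ 2) * (q * 1) := by
        field_simp
    _ ≤ _ := by gcongr
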